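/- Let $\mathbb{D}$ be the open unit disk in $\mathbb{C}\cong\mathbb{R}^2$, $\mathbb{T}=\partial\mathbb{D}$, and let $n\ge 2$ be an integer. Let $\varphi_n\in\mathcal{C}(\overline{\mathbb{D}})$ and $\varphi_k\in\mathcal{C}(\mathbb{T})$ for $k\in\{0,1,\ldots,n-1\}$ be complex-valued, and suppose that $\varphi_0$ is differentiable, i.e. $\theta\mapsto\varphi_0(e^{i\theta})$ is differentiable at every $\theta\in\mathbb{R}$. Let $f\in\mathcal{C}^{2n}(\mathbb{D})$ be a complex-valued solution of the inhomogeneous polyharmonic equation $\Delta^n f=\varphi_n$ in $\mathbb{D}$ with $\Delta^{k}f|_{\mathbb{T}}=\varphi_k$ for $k=0,1,\ldots,n-1$, where $\Delta^0 f=f$ and the boundary condition means that $\Delta^k f(z)\to\varphi_k(\zeta)$ as $z\to\zeta$, $z\in\mathbb{D}$, for every $\zeta\in\mathbb{T}$. For a $2\pi$-periodic $\Psi\in L^1(\mathbb{T})$, the (periodic) Hilbert transform is $$H(\Psi)(\theta)=-\frac1\pi\lim_{\varepsilon\to0^+}\int_{\varepsilon}^{\pi}\frac{\Psi(\theta+t)-\Psi(\theta-t)}{2\tan(t/2)}\,dt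 .$$ Then $f$ is Lipschitz continuous in $\mathbb{D}$ if and only if $\dfrac{d\varphi_0(e^{i\theta})}{d\theta}$ and its Hilbert transform both belong to $L^\infty(\mathbb{T})$ (the Hilbert transform being defined almost everywhere). In particular, if $d\varphi_0(e^{i\theta})/d\theta\in L^\infty(\mathbb{T})$ (equivalently, if $\varphi_0$ is Lipschitz on $\mathbb{T}$), then $f$ is Lipschitz continuous in $\mathbb{D}$ if and only if the Hilbert transform of $d\varphi_0(e^{i\theta})/d\theta$ belongs to $L^\infty(\mathbb{T})$. -/

import Mathlib

open MeasureTheory Filter Topology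

/-- The iterated Laplacian `Δ^k f` of a function on `ℂ ≅ ℝ²` (with `Δ^0 f = f`). At a point of an
open set it depends only on the values of `f` in that open set. -/
noncomputable def iteratedLaplacian (k : ℕ) (f : ℂ → ℂ) : ℂ → ℂ :=
  (fun g : ℂ → ℂ => (Laplacian.laplacian g : ℂ → ℂ))^[k] f

/-- `f` is a classical solution in the unit disk `𝔻` of the inhomogeneous polyharmonic equation
`Δ^n f = φ n` with Dirichlet boundary data `Δ^k f = φ k` on the unit circle `𝕋`, for
`k = 0, …, n - 1`: the function `f` is of class `C^{2n}` in `𝔻`, and each `Δ^k f`, `k < n`, tends to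
`φ k ζ` as `z → ζ`, `z ∈ 𝔻`, for every `ζ ∈ 𝕋`. -/
structure IsPolyharmonicSolution (n : ℕ) (φ : ℕ → ℂ → ℂ) (f : ℂ → ℂ) : Prop where
  contDiffOn : ContDiffOn ℝ ((2 * n : ℕ) : WithTop ℕ∞) f (Metric.ball 0 1)
  equation : ∀ z ∈ Metric.ball (0 : ℂ) 1, iteratedLaplacian n f z = φ n z
  boundary : ∀ k < n, ∀ ζ ∈ Metric.sphere (0 : ℂ) 1,
    Tendsto (iteratedLaplacian k f) (𝓝[Metric.ball 0 1] ζ) (𝓝 (φ k ζ))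

/-- The function `θ ↦ φ (e^{iθ})`. -/
noncomputable def onCircle (φ : ℂ → ℂ) (θ : ℝ) : ℂ :=
  φ (Complex.exp (θ * Complex.I))

/-- The truncated integral `-(1/π) ∫_ε^π (Ψ(θ+t) - Ψ(θ-t)) / (2 tan(t/2)) dt`. -/
noncomputable def truncatedHilbert (Ψ : ℝ → ℂ) (θ ε : ℝ) : ℂ :=
  -(1 / (Real.pi : ℂ)) *
    ∫ t in ε..Real.pi, (Ψ (θ + t) - Ψ (θ - t)) / ((2 * Real.tan (t / 2) : ℝ) : ℂ)

/-- The periodic Hilbert transform of the `2π`-periodic function `Ψ` exists at `θ` (as the limit of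
the truncated integrals when `ε → 0+`) and equals `l`. -/
def HasHilbertTransformAt (Ψ : ℝ → ℂ) (θ : ℝ) (l : ℂ) : Prop :=
  Tendsto (truncatedHilbert Ψ θ) (𝓝[>] 0) (𝓝 l)

/-- The `2π`-periodic function `Ψ` belongs to `L^∞(𝕋)`. -/
def MemLinftyCircle (Ψ : ℝ → ℂ) : Prop :=
  MemLp Ψ ⊤ (volume.restrict (Set.Ioc 0 (2 * Real.pi)))

/-- The periodic Hilbert transform of `Ψ` exists almost everywhere and belongs to `L^∞(𝕋)`. -/
def HilbertTransformMemLinfty (Ψ : ℝ → ℂ) : Prop :=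
  ∃ h : ℝ → ℂ, MemLinftyCircle h ∧
    ∀ᵐ θ ∂(volume.restrict (Set.Ioc 0 (2 * Real.pi))), HasHilbertTransformAt Ψ θ (h θ)

/-! Let `u` be the Poisson integral of `φ 0`. Since `n ≥ 2`, `Δf` has limits at every point of the
circle, so it is bounded in the disk, and `v = f - u` satisfies `Δv = Δf` with zero boundary values.
The maximum principle gives `|v| ≤ N (1 - |z|²) / 4`, and an interior gradient estimate then bounds
the gradient of `v`. Hence `v` is always Lipschitz (`exists_lipschitzOnWith_sub_poissonIntegral`),
and the question is about `u` alone.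

Write `u = a + conj b` with `a`, `b` analytic. The angular derivative of `u` is `i (z a' - conj (z
b'))`, the radial one `r ∂u/∂r` is `z a' + conj (z b')`, and bounds on both make `u` Lipschitz. The
angular one is controlled by the derivative of `φ 0`. For the radial one, the quotient `(φ₀(e^{iθ})
- u((1-ε)e^{iθ})) / ε` and the truncated Hilbert integral of that derivative are integrals of one
second difference against nearly equal kernels. When the derivative is bounded they differ by `o(1)`
at every `θ` (`tendsto_radialQuotient_sub_truncatedHilbert`), so the Hilbert transform is the radial
derivative of `u` on the circle.

If `u` is Lipschitz, the quotients are bounded and so are `a'`, `b'`; for a Lipschitz analytic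
function, differentiability along the circle at a point, true almost everywhere, forces a radial
derivative there (`exists_tendsto_radial_of_hasDerivAt`). Conversely, `r ∂u/∂r` at `z` is a limit of
Poisson integrals of the boundary quotients. These are bounded in `L²`, since radial and angular
derivatives have the same `L²` norm on circles, and the resulting uniform integrability carries the
a.e. bound on the Hilbert transform into the disk (`norm_radial_le`). -/

/-! ### The weak maximum principle for the planar Laplacian. -/

section MaximumPrinciple

variable {F : Type*} [NormedAddCommGroup F] [NormedSpace ℝ F]

theorem deriv_deriv_comp_line {w : ℂ → F} {z : ℂ} (hw : ContDiffAt ℝ 2 w z) (e : ℂ) :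
    deriv (deriv (fun t : ℝ => w (z + t • e))) 0 = iteratedFDeriv ℝ 2 w z ![e, e] := by
  have hline : ∀ t : ℝ, HasDerivAt (fun t : ℝ => z + t • e) e t := fun t => by
    simpa using ((hasDerivAt_id t).smul_const e).const_add z
  have hcont : ContinuousAt (fun t : ℝ => z + t • e) 0 := (hline 0).continuousAt
  have hz : z + (0 : ℝ) • e = z := by simp
  have hev : ∀ᶠ y in 𝓝 z, DifferentiableAt ℝ w y := by
    filter_upwards [hw.eventually (by simp)] with y hy
    exact hy.differentiableAt (by norm_num)
  have h1 : deriv (fun t : ℝ => w (z + t • e)) =ᶠ[𝓝 0] fun t => fderiv ℝ w (z + t • e) e := by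
    have : Tendsto (fun t : ℝ => z + t • e) (𝓝 0) (𝓝 z) := by simpa [ContinuousAt] using hcont
    filter_upwards [this.eventually hev] with t ht
    exact (ht.hasFDerivAt.comp_hasDerivAt t (hline t)).deriv
  rw [h1.deriv_eq, iteratedFDeriv_two_apply]
  have h2 : DifferentiableAt ℝ (fderiv ℝ w) z :=
    (hw.fderiv_right (m := 1) (by norm_num)).differentiableAt (by norm_num)
  have h3 : HasDerivAt (fun t : ℝ => fderiv ℝ w (z + t • e)) (fderiv ℝ (fderiv ℝ w) z e) 0 := by
    exact h2.hasFDerivAt.comp_hasDerivAt_of_eq (0 : ℝ) (hline 0) hz.symm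
  have h4 := h3.clm_apply (hasDerivAt_const (0 : ℝ) e)
  simpa using h4.deriv

theorem laplacian_eq_deriv_deriv {w : ℂ → F} {z : ℂ} (hw : ContDiffAt ℝ 2 w z) :
    Laplacian.laplacian w z = deriv (deriv (fun t : ℝ => w (z + t • (1 : ℂ)))) 0 +
      deriv (deriv (fun t : ℝ => w (z + t • Complex.I))) 0 := by
  rw [deriv_deriv_comp_line hw, deriv_deriv_comp_line hw,
    InnerProductSpace.laplacian_eq_iteratedFDeriv_complexPlane]

/-- A positive second derivative would make `x` a local minimum too, so `g` would be locally
constant. -/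
theorem IsLocalMax.deriv_deriv_nonpos {g : ℝ → ℝ} {x : ℝ} (h : IsLocalMax g x)
    (hc : ContinuousAt g x) : deriv (deriv g) x ≤ 0 := by
  by_contra! hpos
  have hmin := isLocalMin_of_deriv_deriv_pos hpos h.deriv_eq_zero hc
  have hconst : g =ᶠ[𝓝 x] fun _ => g x := by
    filter_upwards [h, hmin] with y h1 h2 using le_antisymm h1 h2
  have h1 : deriv g =ᶠ[𝓝 x] fun _ => 0 := by
    filter_upwards [hconst.eventuallyEq_nhds] with y hy
    rw [hy.deriv_eq, deriv_const]
  rw [h1.deriv_eq] at hpos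
  simp at hpos

theorem IsLocalMax.laplacian_nonpos {w : ℂ → ℝ} {z : ℂ} (h : IsLocalMax w z)
    (hw : ContDiffAt ℝ 2 w z) : Laplacian.laplacian w z ≤ 0 := by
  rw [laplacian_eq_deriv_deriv hw]
  have key : ∀ e : ℂ, deriv (deriv (fun t : ℝ => w (z + t • e))) 0 ≤ 0 := by
    intro e
    have hz : z + (0 : ℝ) • e = z := by simp
    have hcont : ContinuousAt (fun t : ℝ => z + t • e) 0 := by fun_prop
    apply IsLocalMax.deriv_deriv_nonpos
    · have : Tendsto (fun t : ℝ => z + t • e) (𝓝 0) (𝓝 z) := by simpa [ContinuousAt] using hcont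
      filter_upwards [this.eventually h] with t ht
      simpa [hz] using ht
    · apply ContinuousAt.comp (g := w) _ hcont
      rw [hz]; exact hw.continuousAt
  linarith [key 1, key Complex.I]

/-- All the barriers below belong to this family; the linear term serves only the reflection
argument. -/
theorem laplacian_quadratic (a b c k : ℝ) (z : ℂ) :
    Laplacian.laplacian (fun z : ℂ => a * z.re ^ 2 + b * z.im ^ 2 + c * z.re + k) z
      = 2 * a + 2 * b := by
  have hs : ContDiff ℝ 2 (fun z : ℂ => a * z.re ^ 2 + b * z.im ^ 2 + c * z.re + k) := by
    have h1 : ContDiff ℝ 2 Complex.re := Complex.reCLM.contDiff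
    have h2 : ContDiff ℝ 2 Complex.im := Complex.imCLM.contDiff
    fun_prop
  have hq : ∀ p q r : ℝ, deriv (deriv fun t : ℝ => p * t ^ 2 + q * t + r) 0 = 2 * p := by
    intro p q r
    have : deriv (fun t : ℝ => p * t ^ 2 + q * t + r) = fun t => 2 * p * t + q := by
      funext t
      have := (((hasDerivAt_pow 2 t).const_mul p).add ((hasDerivAt_id t).const_mul q)).add_const r
      refine this.deriv.trans ?_
      simp; ring
    rw [this]
    simp
  rw [laplacian_eq_deriv_deriv hs.contDiffAt]
  have e1 : (fun t : ℝ => a * (z + t • (1 : ℂ)).re ^ 2 + b * (z + t • (1 : ℂ)).im ^ 2 +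
      c * (z + t • (1 : ℂ)).re + k) = fun t => a * t ^ 2 + (2 * a * z.re + c) * t +
        (a * z.re ^ 2 + b * z.im ^ 2 + c * z.re + k) := by
    funext t; simp; ring
  have e2 : (fun t : ℝ => a * (z + t • Complex.I).re ^ 2 + b * (z + t • Complex.I).im ^ 2 +
      c * (z + t • Complex.I).re + k) = fun t => b * t ^ 2 + (2 * b * z.im) * t +
        (a * z.re ^ 2 + b * z.im ^ 2 + c * z.re + k) := by
    funext t; simp; ring
  rw [e1, e2, hq, hq]

theorem contDiff_quadratic (a b c k : ℝ) :
    ContDiff ℝ 2 (fun z : ℂ => a * z.re ^ 2 + b * z.im ^ 2 + c * z.re + k) := by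
  have h1 : ContDiff ℝ 2 Complex.re := Complex.reCLM.contDiff
  have h2 : ContDiff ℝ 2 Complex.im := Complex.imCLM.contDiff
  fun_prop

/-- Adding `ε (|z|² - R²)` makes the Laplacian strictly positive, which excludes an interior
maximum, without raising the values on the closure. -/
theorem nonpos_of_laplacian_nonneg {U : Set ℂ} (hU : IsOpen U) (hb : Bornology.IsBounded U)
    {w : ℂ → ℝ} (hc : ContinuousOn w (closure U)) (hw : ∀ z ∈ U, ContDiffAt ℝ 2 w z)
    (hl : ∀ z ∈ U, 0 ≤ Laplacian.laplacian w z) (h0 : ∀ z ∈ frontier U, w z ≤ 0) :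
    ∀ z ∈ U, w z ≤ 0 := by
  intro z₀ hz₀
  obtain ⟨R, hR⟩ := hb.closure.exists_norm_le
  by_contra! hpos
  have hR0 : 0 ≤ R := (norm_nonneg z₀).trans (hR _ (subset_closure hz₀))
  -- Small enough that `ε R² < w z₀`, so the perturbed function is still positive at `z₀`.
  set ε := w z₀ / (R ^ 2 + 1) / 2 with hε
  have hεpos : 0 < ε := by positivity
  set p : ℂ → ℝ := fun z => ε * z.re ^ 2 + ε * z.im ^ 2 + 0 * z.re + (-(ε * R ^ 2)) with hp
  have hpn : ∀ z, p z = ε * ‖z‖ ^ 2 - ε * R ^ 2 := by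
    intro z
    simp only [hp, ← Complex.normSq_eq_norm_sq, Complex.normSq_apply]; ring
  have hcp : ContDiff ℝ 2 p := contDiff_quadratic _ _ _ _
  have hcomp : IsCompact (closure U) := hb.isCompact_closure
  obtain ⟨z₁, hz₁, hmax⟩ := hcomp.exists_isMaxOn ⟨z₀, subset_closure hz₀⟩
    (hc.add hcp.continuous.continuousOn)
  have hval : 0 < w z₀ + p z₀ := by
    rw [hpn]
    have : ε * R ^ 2 < w z₀ := by
      rw [hε, div_div, div_mul_eq_mul_div, div_lt_iff₀ (by positivity)]
      nlinarith [sq_nonneg R]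
    nlinarith [sq_nonneg ‖z₀‖]
  have hval1 : 0 < w z₁ + p z₁ := hval.trans_le (hmax (subset_closure hz₀))
  have hz₁U : z₁ ∈ U := by
    by_contra hn
    have hf : z₁ ∈ frontier U := by rw [hU.frontier_eq]; exact ⟨hz₁, hn⟩
    have h1 := h0 z₁ hf
    have h2 : p z₁ ≤ 0 := by
      rw [hpn]
      have : ‖z₁‖ ^ 2 ≤ R ^ 2 := by
        have := hR z₁ hz₁
        gcongr
      nlinarith
    linarith
  have hloc : IsLocalMax (w + p) z₁ := by
    filter_upwards [hU.mem_nhds hz₁U] with y hy using hmax (subset_closure hy)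
  have := hloc.laplacian_nonpos ((hw z₁ hz₁U).add hcp.contDiffAt)
  rw [(hw z₁ hz₁U).laplacian_add hcp.contDiffAt, hp, laplacian_quadratic] at this
  linarith [hl z₁ hz₁U]

/-- The Laplacian may be computed in any orthonormal basis, here the image under `L` of `1, I`. -/
theorem laplacian_comp_isometry {w : ℂ → F} (c : ℂ) (L : ℂ ≃ₗᵢ[ℝ] ℂ) {z : ℂ}
    (hw : ContDiffAt ℝ 2 w (c + L z)) :
    Laplacian.laplacian (fun z => w (c + L z)) z = Laplacian.laplacian w (c + L z) := by
  have hcd : ContDiffAt ℝ 2 (fun z => w (c + L z)) z := by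
    apply ContDiffAt.comp (g := w) z hw
    exact contDiffAt_const.add L.contDiff.contDiffAt
  rw [laplacian_eq_deriv_deriv hcd,
    InnerProductSpace.laplacian_eq_iteratedFDeriv_orthonormalBasis w
      (Complex.orthonormalBasisOneI.map L)]
  simp only [Fin.sum_univ_two, OrthonormalBasis.map_apply, Complex.coe_orthonormalBasisOneI]
  simp only [Matrix.cons_val_zero, Matrix.cons_val_one]
  rw [← deriv_deriv_comp_line hw, ← deriv_deriv_comp_line hw]
  simp only [map_add, map_smul, add_assoc]

end MaximumPrinciple

/-! ### Gradient estimates from a bounded Laplacian. -/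

section GradientEstimate

/-- The difference `Φ` of `v` and its mirror image vanishes on the line of reflection. On a
rectangle with one side on that line it is compared with the quadratic `-p`, which dominates it on
the boundary and is of order `s` near the line. -/
theorem sub_reflection_le {v : ℂ → ℝ} {z₀ : ℂ} {R A N d s : ℝ} (hd : 0 < d) (hR : 2 * d ≤ R)
    (hv : ∀ z ∈ Metric.ball z₀ R, ContDiffAt ℝ 2 v z)
    (hA : ∀ z ∈ Metric.ball z₀ R, |v z| ≤ A)
    (hN : ∀ z ∈ Metric.ball z₀ R, |Laplacian.laplacian v z| ≤ N)
    (L : ℂ ≃ₗᵢ[ℝ] ℂ) (hs : 0 < s) (hsd : s < d) :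
    v (z₀ + L s) - v (z₀ + L (-s)) ≤ s * (4 * A / d + N * d) := by
  set L' : ℂ ≃ₗᵢ[ℝ] ℂ := (Complex.conjLIE.trans (LinearIsometryEquiv.neg ℝ)).trans L with hL'
  have hL'a : ∀ z, L' z = L (-(starRingEnd ℂ) z) := fun z => by simp [hL']
  -- The coefficients give `Δp = 2N ≥ -ΔΦ`, while on the three sides off the line of reflection `-p
  -- ≥ 2A ≥ Φ`.
  set a := 2 * A / d ^ 2 + N with ha
  set b := -(2 * A / d ^ 2) with hb
  set c := -(4 * A / d + N * d) with hc
  set p : ℂ → ℝ := fun z => a * z.re ^ 2 + b * z.im ^ 2 + c * z.re + 0 with hp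
  set Φ : ℂ → ℝ := fun z => v (z₀ + L z) - v (z₀ + L' z) with hΦ
  set U : Set ℂ := Set.Ioo 0 d ×ℂ Set.Ioo (-d) d with hU
  have hUo : IsOpen U := isOpen_Ioo.reProdIm isOpen_Ioo
  have hUb : Bornology.IsBounded U :=
    (Metric.isBounded_Ioo _ _).reProdIm (Metric.isBounded_Ioo _ _)
  have hcl : closure U = Set.Icc 0 d ×ℂ Set.Icc (-d) d := by
    rw [hU, Complex.closure_reProdIm, closure_Ioo hd.ne, closure_Ioo (by linarith : -d ≠ d)]
  have hnorm : ∀ z ∈ closure U, ‖z‖ < R := by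
    intro z hz
    rw [hcl, Complex.mem_reProdIm] at hz
    obtain ⟨⟨h1, h2⟩, h3, h4⟩ := hz
    have h5 : ‖z‖ ^ 2 < (2 * d) ^ 2 := by
      rw [← Complex.normSq_eq_norm_sq, Complex.normSq_apply]; nlinarith
    exact (lt_of_pow_lt_pow_left₀ 2 (by positivity) h5).trans_le hR
  have hmem : ∀ M : ℂ ≃ₗᵢ[ℝ] ℂ, ∀ z ∈ closure U, z₀ + M z ∈ Metric.ball z₀ R := by
    intro M z hz
    simpa using hnorm z hz
  have hA0 : 0 ≤ A := (abs_nonneg _).trans (hA z₀ (Metric.mem_ball_self (by linarith)))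
  have hN0 : 0 ≤ N := (abs_nonneg _).trans (hN z₀ (Metric.mem_ball_self (by linarith)))
  have hcd : ∀ M : ℂ ≃ₗᵢ[ℝ] ℂ, ∀ z ∈ closure U, ContDiffAt ℝ 2 (fun z => v (z₀ + M z)) z := by
    intro M z hz
    apply ContDiffAt.comp (g := v) z (hv _ (hmem M z hz))
    exact contDiffAt_const.add M.contDiff.contDiffAt
  have hΦcd : ∀ z ∈ closure U, ContDiffAt ℝ 2 Φ z := fun z hz => (hcd L z hz).sub (hcd L' z hz)
  have hpcd : ContDiff ℝ 2 p := contDiff_quadratic _ _ _ _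
  have key := nonpos_of_laplacian_nonneg hUo hUb (w := Φ + p)
    (fun z hz => ((hΦcd z hz).continuousAt.add hpcd.continuous.continuousAt).continuousWithinAt)
    (fun z hz => (hΦcd z (subset_closure hz)).add hpcd.contDiffAt)
    (by
      intro z hz
      have hz' := subset_closure hz
      rw [(hΦcd z hz').laplacian_add hpcd.contDiffAt, hp, laplacian_quadratic]
      have : Laplacian.laplacian Φ z =
          Laplacian.laplacian v (z₀ + L z) - Laplacian.laplacian v (z₀ + L' z) := by
        rw [← laplacian_comp_isometry z₀ L (hv _ (hmem L z hz')),
          ← laplacian_comp_isometry z₀ L' (hv _ (hmem L' z hz')),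
          ← (hcd L z hz').laplacian_sub (hcd L' z hz')]
        rfl
      rw [this]
      have h1 := abs_le.1 (hN _ (hmem L z hz'))
      have h2 := abs_le.1 (hN _ (hmem L' z hz'))
      simp only [ha, hb]
      linarith)
    (by
      intro z hz
      have hz' := frontier_subset_closure hz
      have hzU : z ∉ U := by rw [hUo.frontier_eq] at hz; exact hz.2
      have h1 := abs_le.1 (hA _ (hmem L z hz'))
      have h2 := abs_le.1 (hA _ (hmem L' z hz'))
      have h3 : Φ z ≤ 2 * A := by simp only [hΦ]; linarith
      have hpz : p z = -(2 * A) * ((z.im / d) ^ 2 + (z.re / d) * (2 - z.re / d))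
          - N * z.re * (d - z.re) := by
        simp only [hp, ha, hb, hc]; field_simp; ring
      rw [hcl, Complex.mem_reProdIm] at hz'
      obtain ⟨⟨g1, g2⟩, g3, g4⟩ := hz'
      have hx0 : 0 ≤ z.re / d := by positivity
      have hx1 : z.re / d ≤ 1 := (div_le_one hd).2 g2
      have hNx : 0 ≤ N * z.re * (d - z.re) :=
        mul_nonneg (mul_nonneg hN0 g1) (by linarith)
      simp only [Pi.add_apply]
      by_cases hre : z.re = 0
      · have hzz : L' z = L z := by
          rw [hL'a]; congr 1
          apply Complex.ext <;> simp [hre]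
        have : Φ z = 0 := by simp only [hΦ, hzz, sub_self]
        rw [this, hpz, hre]
        have : 0 ≤ A * (z.im / d) ^ 2 := by positivity
        simp; linarith
      · have hge : 1 ≤ (z.im / d) ^ 2 + (z.re / d) * (2 - z.re / d) := by
          by_cases hre' : z.re = d
          · rw [hre', div_self hd.ne']; nlinarith [sq_nonneg (z.im / d)]
          · have him : z.im = d ∨ z.im = -d := by
              by_contra! hn
              apply hzU
              rw [hU, Complex.mem_reProdIm]
              exact ⟨⟨lt_of_le_of_ne g1 (Ne.symm hre), lt_of_le_of_ne g2 hre'⟩,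
                lt_of_le_of_ne g3 (Ne.symm hn.2), lt_of_le_of_ne g4 hn.1⟩
            have : (z.im / d) ^ 2 = 1 := by
              rcases him with h | h <;> rw [h] <;> field_simp
            rw [this]; nlinarith
        rw [hpz]; nlinarith)
  have hsU : (s : ℂ) ∈ U := by
    rw [hU, Complex.mem_reProdIm]; simp [hs, hsd, hd]
  have h := key s hsU
  simp only [Pi.add_apply, hΦ, hp, hL'a, Complex.conj_ofReal, Complex.ofReal_re,
    Complex.ofReal_im] at h
  have h5 : 0 ≤ a * s ^ 2 := by positivity
  simp only [hc] at h
  nlinarith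

variable {F : Type*} [NormedAddCommGroup F] [NormedSpace ℝ F]

/-- A norming functional reduces to scalar `v` and a rotation to a given direction `e`. The
symmetric difference bounded by `sub_reflection_le` has derivative `2 ‖Dv(e)‖` at `0`; the factor
`2` is given away. -/
theorem norm_fderiv_le_of_laplacian_le {v : ℂ → F} {z₀ : ℂ} {R A N d : ℝ} (hd : 0 < d)
    (hR : 2 * d ≤ R) (hv : ∀ z ∈ Metric.ball z₀ R, ContDiffAt ℝ 2 v z)
    (hA : ∀ z ∈ Metric.ball z₀ R, ‖v z‖ ≤ A)
    (hN : ∀ z ∈ Metric.ball z₀ R, ‖Laplacian.laplacian v z‖ ≤ N) :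
    ‖fderiv ℝ v z₀‖ ≤ 4 * A / d + N * d := by
  have hz₀ : z₀ ∈ Metric.ball z₀ R := Metric.mem_ball_self (by linarith)
  have hA0 : 0 ≤ A := (norm_nonneg _).trans (hA z₀ hz₀)
  have hN0 : 0 ≤ N := (norm_nonneg _).trans (hN z₀ hz₀)
  have hdiff : DifferentiableAt ℝ v z₀ := (hv z₀ hz₀).differentiableAt (by norm_num)
  apply ContinuousLinearMap.opNorm_le_of_unit_norm (by positivity)
  intro e he
  obtain ⟨ℓ, hℓ, hℓe⟩ := exists_dual_vector'' ℝ (fderiv ℝ v z₀ e)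
  set L : ℂ ≃ₗᵢ[ℝ] ℂ := rotation (⟨e, (mem_sphere_zero_iff_norm.2 he :)⟩ : Circle) with hL
  have hLa : ∀ s : ℝ, L s = s • e := fun s => by
    rw [Complex.real_smul, mul_comm]; rfl
  have hℓle : ∀ x, |ℓ x| ≤ ‖x‖ := fun x => by
    have := ℓ.le_of_opNorm_le hℓ x
    simpa using this
  have hbound : ∀ s : ℝ, 0 < s → s < d →
      ℓ (v (z₀ + s • e)) - ℓ (v (z₀ - s • e)) ≤ s * (4 * A / d + N * d) := by
    intro s hs hsd
    have := sub_reflection_le (v := ℓ ∘ v) hd hR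
      (fun z hz => (hv z hz).continuousLinearMap_comp ℓ)
      (fun z hz => (hℓle _).trans (hA z hz))
      (fun z hz => by
        rw [(hv z hz).laplacian_CLM_comp_left]
        exact (hℓle _).trans (hN z hz)) L hs hsd
    have h2 : L (-s) = -(s • e) := by rw [map_neg, hLa]
    rw [hLa, h2] at this
    simpa [sub_eq_add_neg] using this
  have hder : HasDerivAt (fun s : ℝ => ℓ (v (z₀ + s • e)) - ℓ (v (z₀ - s • e)))
      (2 * ‖fderiv ℝ v z₀ e‖) 0 := by
    have l1 : HasDerivAt (fun s : ℝ => z₀ + s • e) e 0 := by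
      simpa using ((hasDerivAt_id (0 : ℝ)).smul_const e).const_add z₀
    have l2 : HasDerivAt (fun s : ℝ => z₀ - s • e) (-e) 0 := by
      simpa using ((hasDerivAt_id (0 : ℝ)).smul_const e).const_sub z₀
    have hf := ℓ.hasFDerivAt.comp z₀ hdiff.hasFDerivAt
    have m1 := hf.comp_hasDerivAt_of_eq (0 : ℝ) l1 (by simp)
    have m2 := hf.comp_hasDerivAt_of_eq (0 : ℝ) l2 (by simp)
    refine (m1.sub m2).congr_deriv ?_
    have : ℓ (fderiv ℝ v z₀ e) = ‖fderiv ℝ v z₀ e‖ := by simpa using hℓe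
    simp [this]; ring
  have hslope := hder.tendsto_slope_zero_right
  have hle : 2 * ‖fderiv ℝ v z₀ e‖ ≤ 4 * A / d + N * d := by
    apply le_of_tendsto hslope
    filter_upwards [Ioo_mem_nhdsGT hd] with s hs
    have := hbound s hs.1 hs.2
    simp only [zero_add, zero_smul, add_zero, sub_zero, sub_self, smul_eq_mul]
    rw [inv_mul_le_iff₀ hs.1]
    exact this
  linarith [norm_nonneg (fderiv ℝ v z₀ e)]

/-- Comparison with `N (1 - |z|²) / 4`, which has Laplacian `-N` and vanishes on the circle. -/
theorem norm_le_of_laplacian_le_of_tendsto_zero {v : ℂ → F} {N : ℝ}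
    (hv : ∀ z ∈ Metric.ball (0 : ℂ) 1, ContDiffAt ℝ 2 v z)
    (hN : ∀ z ∈ Metric.ball (0 : ℂ) 1, ‖Laplacian.laplacian v z‖ ≤ N)
    (hb : ∀ ζ ∈ Metric.sphere (0 : ℂ) 1, Tendsto v (𝓝[Metric.ball 0 1] ζ) (𝓝 0))
    {z : ℂ} (hz : z ∈ Metric.ball (0 : ℂ) 1) : ‖v z‖ ≤ N / 4 * (1 - ‖z‖ ^ 2) := by
  classical
  obtain ⟨ℓ, hℓ, hℓz⟩ := exists_dual_vector'' ℝ (v z)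
  have hℓle : ∀ x, |ℓ x| ≤ ‖x‖ := fun x => by
    have := ℓ.le_of_opNorm_le hℓ x
    simpa using this
  set U := Metric.ball (0 : ℂ) 1 with hU
  have hUo : IsOpen U := Metric.isOpen_ball
  set p : ℂ → ℝ := fun z => N / 4 * z.re ^ 2 + N / 4 * z.im ^ 2 + 0 * z.re + (-(N / 4)) with hp
  have hpn : ∀ z, p z = N / 4 * ‖z‖ ^ 2 - N / 4 := by
    intro z
    simp only [hp, ← Complex.normSq_eq_norm_sq, Complex.normSq_apply]; ring
  have hpcd : ContDiff ℝ 2 p := contDiff_quadratic _ _ _ _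
  -- Only the limits of `v` at the circle are known, not its values there; extension by zero gives
  -- continuity on the closed disk.
  set w : ℂ → ℝ := U.indicator (ℓ ∘ v) with hw
  have hweq : ∀ y ∈ U, w =ᶠ[𝓝 y] ℓ ∘ v := fun y hy => by
    filter_upwards [hUo.mem_nhds hy] with x hx
    simp [hw, hx]
  have hwcd : ∀ y ∈ U, ContDiffAt ℝ 2 w y := fun y hy =>
    ((hv y hy).continuousLinearMap_comp ℓ).congr_of_eventuallyEq (hweq y hy)
  have hcl : closure U = Metric.closedBall 0 1 := closure_ball _ one_ne_zero
  have hfr : frontier U = Metric.sphere 0 1 := frontier_ball _ one_ne_zero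
  have hcont : ContinuousOn w (closure U) := by
    intro y hy
    by_cases hyU : y ∈ U
    · exact (hwcd y hyU).continuousAt.continuousWithinAt
    · have hys : y ∈ Metric.sphere (0 : ℂ) 1 := by
        rw [← hfr, hUo.frontier_eq]; exact ⟨hy, hyU⟩
      have h0 : w y = 0 := by simp [hw, hyU]
      rw [ContinuousWithinAt, h0]
      have h1 : Tendsto w (𝓝[U] y) (𝓝 0) := by
        have := (ℓ.continuous.tendsto 0).comp (hb y hys)
        rw [map_zero] at this
        refine this.congr' ?_
        filter_upwards [self_mem_nhdsWithin] with x hx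
        simp [hw, hx]
      have h2 : Tendsto w (𝓝[Uᶜ] y) (𝓝 0) := by
        refine tendsto_const_nhds.congr' ?_
        filter_upwards [self_mem_nhdsWithin] with x hx
        simp [hw, Set.indicator_of_notMem hx]
      have h3 := h1.sup h2
      rw [← nhdsWithin_union, Set.union_compl_self, nhdsWithin_univ] at h3
      exact h3.mono_left nhdsWithin_le_nhds
  have key := nonpos_of_laplacian_nonneg hUo Metric.isBounded_ball (w := w + p)
    (hcont.add hpcd.continuous.continuousOn)
    (fun y hy => (hwcd y hy).add hpcd.contDiffAt)
    (by
      intro y hy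
      rw [(hwcd y hy).laplacian_add hpcd.contDiffAt, hp, laplacian_quadratic,
        (InnerProductSpace.laplacian_congr_nhds (hweq y hy)).eq_of_nhds,
        (hv y hy).laplacian_CLM_comp_left]
      have := abs_le.1 ((hℓle _).trans (hN y hy))
      simp only [Function.comp_apply]
      linarith)
    (by
      intro y hy
      have hyU : y ∉ U := by rw [hUo.frontier_eq] at hy; exact hy.2
      rw [hfr, mem_sphere_zero_iff_norm] at hy
      simp [hw, hyU, hpn, hy])
  have h1 := key z hz
  have h2 : w z = ‖v z‖ := by simpa [hw, hz] using hℓz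
  simp only [Pi.add_apply, h2, hpn] at h1
  linarith

theorem exists_lipschitzOnWith_of_laplacian_le {v : ℂ → F} {N : ℝ}
    (hv : ∀ z ∈ Metric.ball (0 : ℂ) 1, ContDiffAt ℝ 2 v z)
    (hN : ∀ z ∈ Metric.ball (0 : ℂ) 1, ‖Laplacian.laplacian v z‖ ≤ N)
    (hb : ∀ ζ ∈ Metric.sphere (0 : ℂ) 1, Tendsto v (𝓝[Metric.ball 0 1] ζ) (𝓝 0)) :
    ∃ L : NNReal, LipschitzOnWith L v (Metric.ball 0 1) := by
  have hN0 : 0 ≤ N := (norm_nonneg _).trans (hN 0 (by simp))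
  refine ⟨(9 * N).toNNReal, (convex_ball 0 1).lipschitzOnWith_of_nnnorm_fderiv_le (𝕜 := ℝ)
    (fun z hz => (hv z hz).differentiableAt (by norm_num)) ?_⟩
  intro z hz
  rw [← NNReal.coe_le_coe, coe_nnnorm, Real.coe_toNNReal _ (by positivity)]
  have hz1 : ‖z‖ < 1 := by simpa using hz
  set r := 1 - ‖z‖ with hr
  have hr0 : 0 < r := by linarith
  have hsub : ∀ y ∈ Metric.ball z r, y ∈ Metric.ball (0 : ℂ) 1 ∧ 1 - ‖y‖ ≤ 2 * r := by
    intro y hy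
    rw [mem_ball_iff_norm] at hy
    have h1 := norm_sub_norm_le y z
    have h2 := norm_sub_norm_le z y
    rw [norm_sub_rev] at h2
    rw [mem_ball_zero_iff]
    constructor <;> linarith
  -- The decay of `v` at the boundary gives `|v| ≤ N r` on the ball of radius `r` about `z`, which
  -- cancels the `1 / r` of the estimate: the total is `8N + N r / 2 ≤ 9N`.
  have := norm_fderiv_le_of_laplacian_le (d := r / 2) (R := r) (A := N * r) (N := N)
    (by positivity) (by linarith)
    (fun y hy => hv y (hsub y hy).1)
    (fun y hy => by
      obtain ⟨h1, h2⟩ := hsub y hy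
      refine (norm_le_of_laplacian_le_of_tendsto_zero hv hN hb h1).trans ?_
      rw [mem_ball_zero_iff] at h1
      have : 1 - ‖y‖ ^ 2 ≤ 4 * r := by nlinarith [norm_nonneg y]
      nlinarith)
    (fun y hy => hN y (hsub y hy).1)
  refine this.trans ?_
  have h8 : 4 * (N * r) / (r / 2) = 8 * N := by field_simp; ring
  rw [h8]
  have : r ≤ 1 := by linarith [norm_nonneg z]
  nlinarith

end GradientEstimate

/-- Having a limit at each point of the closed disk bounds `g` locally, and compactness makes the
bound global. It is applied to `Δf`. -/
theorem exists_norm_le_of_tendsto_boundary {E : Type*} [NormedAddCommGroup E] {g : ℂ → E}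
    {b : ℂ → E} (hg : ContinuousOn g (Metric.ball 0 1))
    (hb : ∀ ζ ∈ Metric.sphere (0 : ℂ) 1, Tendsto g (𝓝[Metric.ball 0 1] ζ) (𝓝 (b ζ))) :
    ∃ C, ∀ z ∈ Metric.ball (0 : ℂ) 1, ‖g z‖ ≤ C := by
  have key := (isCompact_closedBall (0 : ℂ) 1).induction_on
    (p := fun s => ∃ C, ∀ z ∈ s ∩ Metric.ball (0 : ℂ) 1, ‖g z‖ ≤ C) ⟨0, by simp⟩
    (fun s t hst ⟨C, hC⟩ => ⟨C, fun z hz => hC z ⟨hst hz.1, hz.2⟩⟩)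
    (fun s t ⟨C, hC⟩ ⟨D, hD⟩ => ⟨max C D, fun z hz => by
      rcases hz.1 with h | h
      · exact (hC z ⟨h, hz.2⟩).trans (le_max_left _ _)
      · exact (hD z ⟨h, hz.2⟩).trans (le_max_right _ _)⟩)
    (fun x hx => by
      have hlim : ∃ l, Tendsto g (𝓝[Metric.ball 0 1] x) (𝓝 l) := by
        rw [mem_closedBall_zero_iff] at hx
        rcases hx.lt_or_eq with h | h
        · exact ⟨g x, hg x (by simpa using h)⟩
        · exact ⟨b x, hb x (by simpa using h)⟩
      obtain ⟨l, hl⟩ := hlim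
      have hev : ∀ᶠ z in 𝓝[Metric.ball 0 1] x, ‖g z‖ ≤ ‖l‖ + 1 :=
        (hl.norm.eventually_lt_const (lt_add_one _)).mono fun _ h => h.le
      rw [eventually_nhdsWithin_iff] at hev
      exact ⟨_, mem_nhdsWithin_of_mem_nhds hev, ‖l‖ + 1, fun z hz => hz.1 hz.2⟩)
  obtain ⟨C, hC⟩ := key
  exact ⟨C, fun z hz => hC z ⟨Metric.ball_subset_closedBall hz, hz⟩⟩

/-! ### Averages over the unit circle: dominated convergence and rotation. -/

section CircleAverage

variable {E : Type*} [NormedAddCommGroup E] [NormedSpace ℝ E]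

theorem norm_circleAverage_le_circleAverage_norm (f : ℂ → E) (c : ℂ) (R : ℝ) :
    ‖Real.circleAverage f c R‖ ≤ Real.circleAverage (fun z => ‖f z‖) c R := by
  rw [Real.circleAverage, Real.circleAverage, norm_smul, smul_eq_mul, Real.norm_of_nonneg
    (by positivity)]
  gcongr
  exact intervalIntegral.norm_integral_le_integral_norm (by positivity)

theorem tendsto_circleAverage_of_dominated {ι : Type*} {l : Filter ι} [l.IsCountablyGenerated]
    {f : ι → ℂ → E} {g : ℂ → E} {C : ℝ}
    (hf : ∀ᶠ i in l, CircleIntegrable (f i) 0 1)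
    (hb : ∀ᶠ i in l, ∀ z ∈ Metric.sphere (0 : ℂ) 1, ‖f i z‖ ≤ C)
    (hlim : ∀ᵐ θ ∂(volume.restrict (Set.Ioc 0 (2 * Real.pi))),
      Tendsto (fun i => f i (circleMap 0 1 θ)) l (𝓝 (g (circleMap 0 1 θ)))) :
    Tendsto (fun i => Real.circleAverage (f i) 0 1) l (𝓝 (Real.circleAverage g 0 1)) := by
  have hIoc : Set.uIoc 0 (2 * Real.pi) = Set.Ioc 0 (2 * Real.pi) :=
    Set.uIoc_of_le (by positivity)
  unfold Real.circleAverage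
  apply Tendsto.const_smul
  apply intervalIntegral.tendsto_integral_filter_of_dominated_convergence (fun _ => C)
  · filter_upwards [hf] with i hi
    rw [hIoc]
    exact hi.1.aestronglyMeasurable
  · filter_upwards [hb] with i hi
    exact Eventually.of_forall fun θ _ => hi _ (circleMap_mem_sphere 0 zero_le_one θ)
  · exact intervalIntegrable_const
  · rw [hIoc]
    exact (ae_restrict_iff' measurableSet_Ioc).1 hlim

theorem circleAverage_rotate (f : ℂ → E) (s : ℝ) :
    Real.circleAverage (fun ξ => f (Complex.exp (s * Complex.I) * ξ)) 0 1 =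
      Real.circleAverage f 0 1 := by
  rw [Real.circleAverage_eq_integral_add (f := f) s, Real.circleAverage]
  congr 2
  ext θ
  simp only [circleMap, zero_add, Complex.ofReal_one, one_mul, ← Complex.exp_add]
  congr 2
  push_cast; ring

end CircleAverage

/-! ### The Poisson integral: analytic splitting, bounds and boundary values. -/

section Poisson

local notation "𝔻" => Metric.ball (0 : ℂ) 1
local notation "𝕋" => Metric.sphere (0 : ℂ) 1
local notation "conj" => starRingEnd _

/-- The Poisson integral over the unit circle of the boundary function `g`. -/
noncomputable def poissonIntegral (g : ℂ → ℂ) (w : ℂ) : ℂ :=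
  Real.circleAverage (fun ξ => poissonKernel 0 w ξ • g ξ) 0 1

/-- The analytic part of the Poisson integral, half of the Herglotz integral. -/
noncomputable def herglotzPart (g : ℂ → ℂ) (w : ℂ) : ℂ :=
  2⁻¹ * Real.circleAverage (fun ξ => herglotzRieszKernel 0 w ξ • g ξ) 0 1

theorem poissonKernel_of_mem_circle {w ξ : ℂ} (hξ : ξ ∈ 𝕋) :
    poissonKernel 0 w ξ = (1 - ‖w‖ ^ 2) / ‖ξ - w‖ ^ 2 := by
  rw [mem_sphere_zero_iff_norm] at hξ
  simp [poissonKernel, hξ]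

theorem poissonKernel_nonneg {w ξ : ℂ} (hw : w ∈ 𝔻) (hξ : ξ ∈ 𝕋) : 0 ≤ poissonKernel 0 w ξ := by
  rw [poissonKernel_of_mem_circle hξ]
  rw [mem_ball_zero_iff] at hw
  have : ‖w‖ ^ 2 ≤ 1 := by nlinarith [norm_nonneg w]
  apply div_nonneg (by linarith) (by positivity)

theorem continuousOn_poissonKernel {w : ℂ} (hw : w ∈ 𝔻) :
    ContinuousOn (poissonKernel 0 w) 𝕋 := by
  rw [poissonKernel_eq_re_herglotzRieszKernel]
  have := continuousOn_herglotzRieszKernel_sphere hw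
  rw [abs_one] at this
  exact Complex.continuous_re.comp_continuousOn this

theorem exists_poissonKernel_le {w : ℂ} (hw : w ∈ 𝔻) :
    ∃ C, 0 < C ∧ ∀ ξ ∈ 𝕋, poissonKernel 0 w ξ ≤ C := by
  obtain ⟨C, hC⟩ := (isCompact_sphere (0 : ℂ) 1).exists_bound_of_continuousOn
    (continuousOn_poissonKernel hw)
  exact ⟨max C 1, by positivity, fun ξ hξ => ((le_abs_self _).trans (hC ξ hξ)).trans (le_max_left _ _)⟩

theorem CircleIntegrable.poissonKernel_smul {E : Type*} [NormedAddCommGroup E] [NormedSpace ℝ E]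
    {g : ℂ → E} (hg : CircleIntegrable g 0 1) {w : ℂ} (hw : w ∈ 𝔻) :
    CircleIntegrable (fun ξ => poissonKernel 0 w ξ • g ξ) 0 1 :=
  hg.continuousOn_smul (by simpa using continuousOn_poissonKernel hw)

theorem circleAverage_poissonKernel {w : ℂ} (hw : w ∈ 𝔻) :
    Real.circleAverage (poissonKernel 0 w) 0 1 = 1 := by
  have h := (diffContOnCl_const (c := (1 : ℂ)) (s := 𝔻) (𝕜 := ℂ)).circleAverage_poissonKernel_smul hw
  have h2 := Complex.ofRealCLM.circleAverage_comp_comm (f := poissonKernel 0 w) (c := 0) (R := 1)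
    (ContinuousOn.circleIntegrable zero_le_one (continuousOn_poissonKernel hw))
  have h3 : (poissonKernel 0 w • fun _ => (1 : ℂ)) = Complex.ofRealCLM ∘ poissonKernel 0 w := by
    ext ξ; simp
  rw [h3, h2] at h
  simpa using h

theorem CircleIntegrable.conj_comp {g : ℂ → ℂ} (hg : CircleIntegrable g 0 1) :
    CircleIntegrable (fun ξ => conj (g ξ)) 0 1 := by
  simp only [CircleIntegrable, intervalIntegrable_iff] at hg ⊢
  exact Complex.conjCLE.toContinuousLinearMap.integrable_comp hg

/-- The Poisson kernel is the real part of the Herglotz kernel, that is, half its sum with its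
conjugate. -/
theorem poissonIntegral_eq_add_conj {g : ℂ → ℂ} (hg : CircleIntegrable g 0 1) {w : ℂ}
    (hw : w ∈ 𝔻) :
    poissonIntegral g w =
      herglotzPart g w + conj (herglotzPart (fun ξ => conj (g ξ)) w) := by
  have hk := continuousOn_herglotzRieszKernel_sphere hw
  have h1 : CircleIntegrable (fun ξ => herglotzRieszKernel 0 w ξ • g ξ) 0 1 :=
    hg.continuousOn_smul hk
  have h2 : CircleIntegrable (fun ξ => herglotzRieszKernel 0 w ξ • conj (g ξ)) 0 1 :=
    hg.conj_comp.continuousOn_smul hk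
  have h3 := Complex.conjCLE.toContinuousLinearMap.circleAverage_comp_comm h2
  have h4 : conj (herglotzPart (fun ξ => conj (g ξ)) w) = 2⁻¹ *
      Real.circleAverage (fun ξ => conj (herglotzRieszKernel 0 w ξ) * g ξ) 0 1 := by
    rw [herglotzPart, map_mul]
    congr 1
    · rw [map_inv₀, map_ofNat]
    · refine Eq.trans h3.symm ?_
      congr 1; ext ξ; simp
  have h5 : CircleIntegrable (fun ξ => conj (herglotzRieszKernel 0 w ξ) * g ξ) 0 1 := by
    have := h2.conj_comp
    simpa using this
  rw [h4, herglotzPart, ← mul_add, ← Real.circleAverage_fun_add h1 h5, poissonIntegral,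
    ← smul_eq_mul, ← Real.circleAverage_fun_smul]
  congr 1; ext ξ
  rw [poissonKernel_eq_re_herglotzRieszKernel, smul_eq_mul, smul_eq_mul, ← add_mul,
    Complex.add_conj, Complex.real_smul]
  simp; ring

theorem analyticOnNhd_herglotzPart {g : ℂ → ℂ} (hg : CircleIntegrable g 0 1) :
    AnalyticOnNhd ℂ (herglotzPart g) 𝔻 :=
  analyticOnNhd_const.mul (analyticOnNhd_circleAverage_herglotzRieszKernel_smul hg)

theorem harmonicOnNhd_poissonIntegral {g : ℂ → ℂ} (hg : CircleIntegrable g 0 1) :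
    InnerProductSpace.HarmonicOnNhd (poissonIntegral g) 𝔻 := by
  intro w hw
  have heq : poissonIntegral g =ᶠ[𝓝 w]
      herglotzPart g + conj (herglotzPart (fun ξ => conj (g ξ))) := by
    filter_upwards [Metric.isOpen_ball.mem_nhds hw] with z hz
    exact poissonIntegral_eq_add_conj hg hz
  rw [InnerProductSpace.harmonicAt_congr_nhds heq]
  exact (analyticOnNhd_herglotzPart hg w hw).harmonicAt.add
    (analyticOnNhd_herglotzPart hg.conj_comp w hw).harmonicAt_conj

theorem poissonIntegral_of_diffContOnCl {a b : ℂ → ℂ} (ha : DiffContOnCl ℂ a 𝔻)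
    (hb : DiffContOnCl ℂ b 𝔻) {w : ℂ} (hw : w ∈ 𝔻) :
    poissonIntegral (fun z => a z + conj (b z)) w = a w + conj (b w) := by
  have h1 := ha.circleAverage_poissonKernel_smul hw
  have h2 := hb.circleAverage_poissonKernel_smul hw
  have hai : CircleIntegrable a 0 1 := (ha.continuousOn_ball.mono
    Metric.sphere_subset_closedBall).circleIntegrable zero_le_one
  have hbi : CircleIntegrable b 0 1 := (hb.continuousOn_ball.mono
    Metric.sphere_subset_closedBall).circleIntegrable zero_le_one
  have h3 := Complex.conjCLE.toContinuousLinearMap.circleAverage_comp_comm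
    (hbi.poissonKernel_smul hw)
  have h4 : Real.circleAverage (fun ξ => poissonKernel 0 w ξ • conj (b ξ)) 0 1 = conj (b w) := by
    rw [← h2]
    refine Eq.trans ?_ h3
    congr 1; ext ξ; simp
  rw [poissonIntegral, ← h4]
  conv_rhs => rw [← h1]
  refine Eq.trans ?_ (Real.circleAverage_add (hai.poissonKernel_smul hw) (hbi.conj_comp.poissonKernel_smul hw))
  congr 1; ext ξ
  simp

theorem norm_poissonIntegral_le {g : ℂ → ℂ} {w : ℂ} (hw : w ∈ 𝔻) :
    ‖poissonIntegral g w‖ ≤ Real.circleAverage (fun ξ => poissonKernel 0 w ξ * ‖g ξ‖) 0 1 := by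
  refine (norm_circleAverage_le_circleAverage_norm _ _ _).trans_eq ?_
  apply Real.circleAverage_congr_sphere
  intro ξ hξ
  rw [abs_one] at hξ
  simp only [norm_smul, Real.norm_of_nonneg (poissonKernel_nonneg hw hξ)]

theorem norm_poissonIntegral_le_of_le {g : ℂ → ℂ} {C : ℝ} (hC : ∀ ξ ∈ 𝕋, ‖g ξ‖ ≤ C) {w : ℂ}
    (hw : w ∈ 𝔻) (hg : CircleIntegrable g 0 1) : ‖poissonIntegral g w‖ ≤ C := by
  refine (norm_poissonIntegral_le hw).trans ?_
  have hk : CircleIntegrable (poissonKernel 0 w) 0 1 :=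
    ContinuousOn.circleIntegrable zero_le_one (continuousOn_poissonKernel hw)
  have h1 : CircleIntegrable (fun ξ => poissonKernel 0 w ξ * ‖g ξ‖) 0 1 := by
    have : CircleIntegrable (fun ξ => ‖g ξ‖) 0 1 := IntervalIntegrable.norm hg
    simpa using this.poissonKernel_smul hw
  refine (Real.circleAverage_mono h1 (hk.const_smul (a := C)) ?_).trans_eq ?_
  · intro ξ hξ
    rw [abs_one] at hξ
    simp only [Pi.smul_apply, smul_eq_mul]
    rw [mul_comm]
    exact mul_le_mul_of_nonneg_right (hC ξ hξ) (poissonKernel_nonneg hw hξ)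
  · rw [Real.circleAverage_smul, circleAverage_poissonKernel hw, smul_eq_mul, mul_one]

theorem poissonIntegral_sub {g h : ℂ → ℂ} (hg : CircleIntegrable g 0 1)
    (hh : CircleIntegrable h 0 1) {w : ℂ} (hw : w ∈ 𝔻) :
    poissonIntegral (fun ξ => g ξ - h ξ) w = poissonIntegral g w - poissonIntegral h w := by
  simp only [poissonIntegral, smul_sub]
  exact Real.circleAverage_fun_sub (hg.poissonKernel_smul hw) (hh.poissonKernel_smul hw)

theorem poissonIntegral_const (a : ℂ) {w : ℂ} (hw : w ∈ 𝔻) :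
    poissonIntegral (fun _ => a) w = a :=
  (diffContOnCl_const (c := a)).circleAverage_poissonKernel_smul hw

theorem poissonIntegral_const_mul (a : ℂ) (g : ℂ → ℂ) (w : ℂ) :
    poissonIntegral (fun ξ => a * g ξ) w = a * poissonIntegral g w := by
  rw [poissonIntegral, poissonIntegral, ← smul_eq_mul a, ← Real.circleAverage_fun_smul]
  congr 1; ext ξ
  simp; ring

/-- The kernel is an approximate identity. Continuity is required at `ζ` only, because the result is
later applied to a difference quotient that may be discontinuous elsewhere. -/
theorem tendsto_poissonIntegral {g : ℂ → ℂ} (hg : CircleIntegrable g 0 1) {C : ℝ}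
    (hC : ∀ ξ ∈ 𝕋, ‖g ξ‖ ≤ C) {ζ : ℂ} (hζ : ζ ∈ 𝕋) (hc : ContinuousWithinAt g 𝕋 ζ) :
    Tendsto (poissonIntegral g) (𝓝[𝔻] ζ) (𝓝 (g ζ)) := by
  rw [Metric.tendsto_nhds]
  intro ε hε
  obtain ⟨δ, hδ, hgδ⟩ := Metric.continuousWithinAt_iff.1 hc (ε / 2) (by positivity)
  have hC0 : 0 ≤ C := (norm_nonneg _).trans (hC ζ hζ)
  have hlim : Tendsto (fun w : ℂ => 2 * C * ((1 - ‖w‖ ^ 2) / (δ / 2) ^ 2)) (𝓝[𝔻] ζ) (𝓝 0) := by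
    have : Continuous (fun w : ℂ => 2 * C * ((1 - ‖w‖ ^ 2) / (δ / 2) ^ 2)) := by fun_prop
    have h := this.tendsto ζ
    rw [mem_sphere_zero_iff_norm] at hζ
    simp only [hζ] at h
    simpa using h.mono_left nhdsWithin_le_nhds
  filter_upwards [self_mem_nhdsWithin, mem_nhdsWithin_of_mem_nhds (Metric.ball_mem_nhds ζ
    (half_pos hδ)), hlim.eventually_lt_const (half_pos hε)] with w hw hwζ hwε
  rw [dist_eq_norm, ← poissonIntegral_const (g ζ) hw,
    ← poissonIntegral_sub hg (circleIntegrable_const _ _ _) hw]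
  refine (norm_poissonIntegral_le hw).trans_lt ?_
  have hk : CircleIntegrable (poissonKernel 0 w) 0 1 :=
    ContinuousOn.circleIntegrable zero_le_one (continuousOn_poissonKernel hw)
  have h1 : CircleIntegrable (fun ξ => poissonKernel 0 w ξ * ‖g ξ - g ζ‖) 0 1 := by
    have : CircleIntegrable (fun ξ => ‖g ξ - g ζ‖) 0 1 :=
      IntervalIntegrable.norm (hg.sub (circleIntegrable_const _ _ _))
    simpa using this.poissonKernel_smul hw
  have h2 : Real.circleAverage (fun ξ => poissonKernel 0 w ξ * ‖g ξ - g ζ‖) 0 1 ≤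
      Real.circleAverage (((ε / 2) • poissonKernel 0 w) +
        fun _ => 2 * C * ((1 - ‖w‖ ^ 2) / (δ / 2) ^ 2)) 0 1 := by
    refine Real.circleAverage_mono h1 ((hk.const_smul).add (circleIntegrable_const _ _ _)) ?_
    intro ξ hξ
    rw [abs_one] at hξ
    have hp := poissonKernel_nonneg hw hξ
    have hw1 : 0 ≤ 1 - ‖w‖ ^ 2 := by
      rw [mem_ball_zero_iff] at hw
      nlinarith [norm_nonneg w]
    simp only [Pi.add_apply, Pi.smul_apply, smul_eq_mul]
    by_cases hd : dist ξ ζ < δ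
    · have := (hgδ hξ hd).le
      rw [dist_eq_norm] at this
      have h3 : 0 ≤ 2 * C * ((1 - ‖w‖ ^ 2) / (δ / 2) ^ 2) := by positivity
      nlinarith
    · have h4 : ‖g ξ - g ζ‖ ≤ 2 * C := (norm_sub_le _ _).trans (by linarith [hC ξ hξ, hC ζ hζ])
      have h5 : poissonKernel 0 w ξ ≤ (1 - ‖w‖ ^ 2) / (δ / 2) ^ 2 := by
        rw [poissonKernel_of_mem_circle hξ]
        have : δ / 2 ≤ ‖ξ - w‖ := by
          have := dist_triangle ξ w ζ
          rw [Metric.mem_ball] at hwζ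
          rw [← dist_eq_norm]
          linarith
        gcongr
      have h6 : 0 ≤ ε / 2 * poissonKernel 0 w ξ := by positivity
      have h7 := mul_le_mul h5 h4 (norm_nonneg _) (by positivity)
      linarith
  refine h2.trans_lt ?_
  rw [Real.circleAverage_add hk.const_smul (circleIntegrable_const _ _ _),
    Real.circleAverage_smul, circleAverage_poissonKernel hw, Real.circleAverage_const]
  simp only [smul_eq_mul]
  linarith

theorem poissonIntegral_rotate (g : ℂ → ℂ) (w : ℂ) (s : ℝ) :
    poissonIntegral g (Complex.exp (s * Complex.I) * w) =
      poissonIntegral (fun ξ => g (Complex.exp (s * Complex.I) * ξ)) w := by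
  rw [poissonIntegral, ← circleAverage_rotate _ s, poissonIntegral]
  congr 1; ext ξ
  congr 1
  simp [poissonKernel, ← mul_sub, Complex.norm_exp_ofReal_mul_I]

end Poisson

/-! ### Comparison of the Poisson and Hilbert kernels on second differences. -/

section HilbertKernel

/-- The second difference `F (θ + t) + F (θ - t) - 2 F θ`. -/
noncomputable def symmDiff₂ (F : ℝ → ℂ) (θ t : ℝ) : ℂ := F (θ + t) + F (θ - t) - 2 * F θ

theorem continuous_symmDiff₂ {F : ℝ → ℂ} (hF : Continuous F) (θ : ℝ) :
    Continuous (symmDiff₂ F θ) := by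
  unfold symmDiff₂; fun_prop

theorem hasDerivAt_symmDiff₂ {F : ℝ → ℂ} (hF : Differentiable ℝ F) (θ t : ℝ) :
    HasDerivAt (symmDiff₂ F θ) (deriv F (θ + t) - deriv F (θ - t)) t := by
  have h1 := (hF (θ + t)).hasDerivAt.comp_const_add θ t
  have h2 := (hF (θ - t)).hasDerivAt.comp_const_sub θ t
  have := (h1.add h2).sub_const (2 * F θ)
  exact this.congr_deriv (by ring)

/-- The second difference vanishes to first order at `t = 0` by mere differentiability at `θ`. Away
from `0` the cubic term absorbs the bound; the exponent `3` matches the `t⁻³` of `kernel_sub_le`. -/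
theorem exists_norm_symmDiff₂_le {F : ℝ → ℂ} (hF : Differentiable ℝ F) (θ : ℝ) {η : ℝ}
    (hη : 0 < η) :
    ∃ C, 0 ≤ C ∧ ∀ t ∈ Set.Icc 0 Real.pi, ‖symmDiff₂ F θ t‖ ≤ η * t + C * t ^ 3 := by
  have h0 : symmDiff₂ F θ 0 = 0 := by simp [symmDiff₂]; ring
  have hd := hasDerivAt_symmDiff₂ hF θ 0
  rw [add_zero, sub_zero, sub_self, hasDerivAt_iff_isLittleO, Asymptotics.isLittleO_iff] at hd
  obtain ⟨δ, hδ, hE⟩ := Metric.eventually_nhds_iff.1 (hd hη)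
  obtain ⟨B, hB⟩ := (isCompact_Icc (a := 0) (b := Real.pi)).exists_bound_of_continuousOn
    (continuous_symmDiff₂ hF.continuous θ).continuousOn
  have hB0 : 0 ≤ B := (norm_nonneg _).trans (hB 0 ⟨le_rfl, Real.pi_pos.le⟩)
  refine ⟨B / δ ^ 3, by positivity, fun t ht => ?_⟩
  have ht0 := ht.1
  by_cases htδ : t < δ
  · have := hE (y := t) (by simpa [abs_of_nonneg ht0] using htδ)
    simp only [h0, sub_zero, smul_zero, Real.norm_of_nonneg ht0] at this
    have : 0 ≤ B / δ ^ 3 * t ^ 3 := by positivity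
    linarith
  · push Not at htδ
    have h1 : 1 ≤ t ^ 3 / δ ^ 3 := by
      rw [one_le_div (by positivity)]; gcongr
    have h2 : B ≤ B / δ ^ 3 * t ^ 3 := by
      calc B = B * 1 := (mul_one _).symm
        _ ≤ B * (t ^ 3 / δ ^ 3) := by gcongr
        _ = _ := by ring
    have := hB t ht
    have : 0 ≤ η * t := by positivity
    linarith

theorem div_pi_le_sin_half {t : ℝ} (h0 : 0 ≤ t) (h1 : t ≤ Real.pi) :
    t / Real.pi ≤ Real.sin (t / 2) := by
  have := Real.mul_le_sin (x := t / 2) (by linarith) (by linarith)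
  calc t / Real.pi = 2 / Real.pi * (t / 2) := by ring
    _ ≤ _ := this

theorem sin_half_pos {t : ℝ} (h0 : 0 < t) (h1 : t ≤ Real.pi) : 0 < Real.sin (t / 2) :=
  (div_pos h0 Real.pi_pos).trans_le (div_pi_le_sin_half h0.le h1)

/-- Integration by parts against `cot (t/2) / 2`; the boundary term at `π` disappears since `cos
(π/2) = 0`. -/
theorem truncatedHilbert_deriv_eq {F : ℝ → ℂ} (hF : Differentiable ℝ F) {M : ℝ}
    (hM : ∀ x, ‖deriv F x‖ ≤ M) (θ : ℝ) {ε : ℝ} (hε : 0 < ε) (hεπ : ε ≤ Real.pi) :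
    truncatedHilbert (deriv F) θ ε = -(1 / (Real.pi : ℂ)) *
      (-((Real.cos (ε / 2) / (2 * Real.sin (ε / 2))) • symmDiff₂ F θ ε) +
        ∫ t in ε..Real.pi, (1 / (4 * Real.sin (t / 2) ^ 2)) • symmDiff₂ F θ t) := by
  have hpos : ∀ t ∈ Set.uIcc ε Real.pi, 0 < Real.sin (t / 2) := by
    intro t ht
    rw [Set.uIcc_of_le hεπ] at ht
    exact sin_half_pos (hε.trans_le ht.1) ht.2
  have hu : ∀ t ∈ Set.uIcc ε Real.pi,
      HasDerivAt (fun t => Real.cos (t / 2) / (2 * Real.sin (t / 2)))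
        (-(1 / (4 * Real.sin (t / 2) ^ 2))) t := by
    intro t ht
    have hs := (hpos t ht).ne'
    have h1 : HasDerivAt (fun t : ℝ => t / 2) (1 / 2) t := (hasDerivAt_id t).div_const 2
    have h2 := (Real.hasDerivAt_cos (t / 2)).comp t h1
    have h3 := ((Real.hasDerivAt_sin (t / 2)).comp t h1).const_mul 2
    refine (h2.div h3 (by simpa using hs)).congr_deriv ?_
    simp only [Function.comp_apply]
    field_simp
    linear_combination -4 * Real.sin_sq_add_cos_sq (t / 2)
  have hcont : ContinuousOn (fun t => -(1 / (4 * Real.sin (t / 2) ^ 2))) (Set.uIcc ε Real.pi) := by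
    apply ContinuousOn.neg
    apply ContinuousOn.div continuousOn_const (by fun_prop)
    intro t ht
    have := hpos t ht
    positivity
  have hint : IntervalIntegrable (fun t => deriv F (θ + t) - deriv F (θ - t)) volume ε Real.pi := by
    have hb : ∀ x, ‖deriv F (θ + x) - deriv F (θ - x)‖ ≤ M + M := fun x =>
      (norm_sub_le _ _).trans (add_le_add (hM _) (hM _))
    have hm : Measurable (fun t => deriv F (θ + t) - deriv F (θ - t)) := by
      have := measurable_deriv F
      fun_prop
    exact (intervalIntegrable_const (c := M + M)).mono_fun' hm.aestronglyMeasurable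
      (Eventually.of_forall hb)
  have key := intervalIntegral.integral_smul_deriv_eq_deriv_smul hu
    (fun t _ => hasDerivAt_symmDiff₂ hF θ t) hcont.intervalIntegrable hint
  rw [truncatedHilbert]
  congr 1
  have hker : ∀ t, (deriv F (θ + t) - deriv F (θ - t)) / ((2 * Real.tan (t / 2) : ℝ) : ℂ) =
      (Real.cos (t / 2) / (2 * Real.sin (t / 2))) • (deriv F (θ + t) - deriv F (θ - t)) := by
    intro t
    have : Real.cos (t / 2) / (2 * Real.sin (t / 2)) = (2 * Real.tan (t / 2))⁻¹ := by
      rw [Real.tan_eq_sin_div_cos, mul_div_assoc', inv_div]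
    rw [this, Complex.real_smul, Complex.ofReal_inv, div_eq_inv_mul]
  simp only [hker]
  rw [key]
  simp only [neg_smul, intervalIntegral.integral_neg]
  simp

/-- The first kernel is the Poisson kernel of radius `1 - ε` divided by `2ε`. The leading terms `4
sin²(t/2)` cancel in the numerator of the difference, leaving a factor `ε`. -/
theorem kernel_sub_le {t ε : ℝ} (hε : 0 < ε) (hε2 : ε ≤ 1 / 2) (ht : ε ≤ t)
    (htπ : t ≤ Real.pi) :
    |(1 + (1 - ε)) / 2 / (ε ^ 2 + 4 * (1 - ε) * Real.sin (t / 2) ^ 2) -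
      1 / (4 * Real.sin (t / 2) ^ 2)| ≤ Real.pi ^ 4 * ε / t ^ 3 := by
  have ht0 : 0 < t := hε.trans_le ht
  have hpi := Real.pi_pos
  set s := Real.sin (t / 2) with hs
  have hs0 : 0 < s := sin_half_pos ht0 htπ
  have hst : t / Real.pi ≤ s := div_pi_le_sin_half ht0.le htπ
  have hden : 0 < ε ^ 2 + 4 * (1 - ε) * s ^ 2 := by nlinarith [sq_nonneg ε, sq_pos_of_pos hs0]
  have heq : (1 + (1 - ε)) / 2 / (ε ^ 2 + 4 * (1 - ε) * s ^ 2) - 1 / (4 * s ^ 2) =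
      (2 * s ^ 2 * ε - ε ^ 2) / ((4 * s ^ 2) * (ε ^ 2 + 4 * (1 - ε) * s ^ 2)) := by
    rw [div_sub_div _ _ hden.ne' (by positivity), div_eq_div_iff (by positivity) (by positivity)]
    ring
  rw [heq, abs_div, abs_of_pos (by positivity : 0 < (4 * s ^ 2) * (ε ^ 2 + 4 * (1 - ε) * s ^ 2))]
  have h1 : |2 * s ^ 2 * ε - ε ^ 2| ≤ 2 * s ^ 2 * ε + ε ^ 2 := by
    rw [abs_le]; constructor <;> nlinarith [sq_nonneg ε, mul_pos (sq_pos_of_pos hs0) hε]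
  have h2 : 8 * s ^ 4 ≤ (4 * s ^ 2) * (ε ^ 2 + 4 * (1 - ε) * s ^ 2) := by
    have : 2 * s ^ 2 ≤ ε ^ 2 + 4 * (1 - ε) * s ^ 2 := by
      nlinarith [sq_nonneg ε, sq_pos_of_pos hs0]
    nlinarith [sq_pos_of_pos hs0]
  calc |2 * s ^ 2 * ε - ε ^ 2| / ((4 * s ^ 2) * (ε ^ 2 + 4 * (1 - ε) * s ^ 2))
      ≤ (2 * s ^ 2 * ε + ε ^ 2) / (8 * s ^ 4) := by gcongr
    _ = ε / (4 * s ^ 2) + ε ^ 2 / (8 * s ^ 4) := by field_simp; ring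
    _ ≤ ε / (4 * (t / Real.pi) ^ 2) + ε ^ 2 / (8 * (t / Real.pi) ^ 4) := by gcongr
    _ = ε * Real.pi ^ 2 * t / (4 * t ^ 3) + ε * ε * Real.pi ^ 4 / (8 * (t ^ 3 * t)) := by
        field_simp
    _ ≤ ε * Real.pi ^ 2 * Real.pi / (4 * t ^ 3) + ε * t * Real.pi ^ 4 / (8 * (t ^ 3 * t)) := by
        gcongr
    _ = (Real.pi ^ 3 / 4 + Real.pi ^ 4 / 8) * ε / t ^ 3 := by field_simp
    _ ≤ Real.pi ^ 4 * ε / t ^ 3 := by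
        have h3 := Real.pi_gt_three
        have h4 : 0 < Real.pi ^ 3 := by positivity
        gcongr
        nlinarith

theorem integral_inv_sq_le {ε : ℝ} (hε : 0 < ε) (hεπ : ε ≤ Real.pi) :
    ∫ t in ε..Real.pi, 1 / t ^ 2 ≤ 1 / ε := by
  have hd : ∀ t ∈ Set.uIcc ε Real.pi, HasDerivAt (fun t : ℝ => -t⁻¹) (1 / t ^ 2) t := by
    intro t ht
    rw [Set.uIcc_of_le hεπ] at ht
    have := (hasDerivAt_inv (hε.trans_le ht.1).ne').neg
    exact this.congr_deriv (by simp)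
  have hc : ContinuousOn (fun t : ℝ => 1 / t ^ 2) (Set.uIcc ε Real.pi) := by
    apply ContinuousOn.div continuousOn_const (by fun_prop)
    intro t ht
    rw [Set.uIcc_of_le hεπ] at ht
    have := hε.trans_le ht.1
    positivity
  rw [intervalIntegral.integral_eq_sub_of_hasDerivAt hd hc.intervalIntegrable]
  have := Real.pi_pos
  have : 0 < Real.pi⁻¹ := by positivity
  rw [one_div]
  linarith

/-- The constants `1`, `π`, `π⁴` come from the integral over `[0, ε]`, where the kernel is at most
`1/ε²`, from the boundary term at `ε`, and from the kernel difference on `[ε, π]`. -/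
theorem norm_integral_kernel_sub_le {E : ℝ → ℂ} (hE : Continuous E) {η C : ℝ} (hη : 0 ≤ η)
    (hC : 0 ≤ C) (hb : ∀ t ∈ Set.Icc 0 Real.pi, ‖E t‖ ≤ η * t + C * t ^ 3) {ε : ℝ} (hε : 0 < ε)
    (hε2 : ε ≤ 1 / 2) :
    ‖(∫ t in 0..Real.pi,
        ((1 + (1 - ε)) / 2 / (ε ^ 2 + 4 * (1 - ε) * Real.sin (t / 2) ^ 2)) • E t) -
      (-((Real.cos (ε / 2) / (2 * Real.sin (ε / 2))) • E ε) +
        ∫ t in ε..Real.pi, (1 / (4 * Real.sin (t / 2) ^ 2)) • E t)‖ ≤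
      (1 + Real.pi + Real.pi ^ 4) * (η + C * Real.pi * ε) := by
  have hpi3 := Real.pi_gt_three
  have hεπ : ε ≤ Real.pi := by linarith
  have hden : ∀ t, 0 < ε ^ 2 + 4 * (1 - ε) * Real.sin (t / 2) ^ 2 := by
    intro t
    have : 0 ≤ 4 * (1 - ε) * Real.sin (t / 2) ^ 2 :=
      mul_nonneg (by linarith) (sq_nonneg _)
    positivity
  have hc1 : Continuous fun t =>
      ((1 + (1 - ε)) / 2 / (ε ^ 2 + 4 * (1 - ε) * Real.sin (t / 2) ^ 2)) • E t := by
    apply Continuous.fun_smul _ hE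
    exact Continuous.div continuous_const (by fun_prop) fun t => (hden t).ne'
  have hc2 : ContinuousOn (fun t => (1 / (4 * Real.sin (t / 2) ^ 2)) • E t)
      (Set.uIcc ε Real.pi) := by
    apply ContinuousOn.fun_smul _ hE.continuousOn
    apply ContinuousOn.div continuousOn_const (by fun_prop)
    intro t ht
    rw [Set.uIcc_of_le hεπ] at ht
    have := sin_half_pos (hε.trans_le ht.1) ht.2
    positivity
  rw [← intervalIntegral.integral_add_adjacent_intervals (hc1.intervalIntegrable 0 ε)
    (hc1.intervalIntegrable ε Real.pi)]
  set I1 := ∫ t in 0..ε,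
    ((1 + (1 - ε)) / 2 / (ε ^ 2 + 4 * (1 - ε) * Real.sin (t / 2) ^ 2)) • E t with hI1
  have hrew : ∀ a b c d : ℂ, a + b - (-c + d) = a + c + (b - d) := by intros; ring
  rw [hrew, ← intervalIntegral.integral_sub (hc1.intervalIntegrable ε Real.pi)
    hc2.intervalIntegrable]
  have hCε : C * ε ^ 2 ≤ C * Real.pi * ε := by nlinarith [mul_nonneg hC hε.le]
  have b1 : ‖I1‖ ≤ η + C * Real.pi * ε := by
    have h := intervalIntegral.norm_integral_le_of_norm_le_const (a := 0) (b := ε)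
      (C := (η * ε + C * ε ^ 3) / ε ^ 2)
      (f := fun t => ((1 + (1 - ε)) / 2 / (ε ^ 2 + 4 * (1 - ε) * Real.sin (t / 2) ^ 2)) • E t) ?_
    · rw [sub_zero, abs_of_pos hε] at h
      refine h.trans ?_
      have : (η * ε + C * ε ^ 3) / ε ^ 2 * ε = η + C * ε ^ 2 := by field_simp
      rw [this]; linarith
    · intro t ht
      rw [Set.uIoc_of_le hε.le] at ht
      have ht0 := ht.1.le
      rw [norm_smul, Real.norm_of_nonneg (div_nonneg (by linarith) (hden t).le)]
      have hk : (1 + (1 - ε)) / 2 / (ε ^ 2 + 4 * (1 - ε) * Real.sin (t / 2) ^ 2) ≤ 1 / ε ^ 2 := by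
        apply div_le_div₀ zero_le_one (by linarith) (by positivity)
        have : 0 ≤ 4 * (1 - ε) * Real.sin (t / 2) ^ 2 := mul_nonneg (by linarith) (sq_nonneg _)
        linarith
      have he : ‖E t‖ ≤ η * ε + C * ε ^ 3 := by
        refine (hb t ⟨ht0, ht.2.trans hεπ⟩).trans ?_
        have := ht.2
        gcongr
      calc _ ≤ 1 / ε ^ 2 * (η * ε + C * ε ^ 3) := mul_le_mul hk he (norm_nonneg _) (by positivity)
        _ = _ := by ring
  have b2 : ‖(Real.cos (ε / 2) / (2 * Real.sin (ε / 2))) • E ε‖ ≤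
      Real.pi * (η + C * Real.pi * ε) := by
    have hs := sin_half_pos hε hεπ
    have hs' := div_pi_le_sin_half hε.le hεπ
    rw [norm_smul, Real.norm_eq_abs, abs_div, abs_of_pos (by positivity : 0 < 2 * Real.sin (ε / 2))]
    have hk : |Real.cos (ε / 2)| / (2 * Real.sin (ε / 2)) ≤ 1 / (2 * (ε / Real.pi)) := by
      gcongr
      exact Real.abs_cos_le_one _
    calc _ ≤ 1 / (2 * (ε / Real.pi)) * (η * ε + C * ε ^ 3) :=
          mul_le_mul hk (hb ε ⟨hε.le, hεπ⟩) (norm_nonneg _) (by positivity)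
      _ = Real.pi / 2 * (η + C * ε ^ 2) := by field_simp
      _ ≤ Real.pi * (η + C * Real.pi * ε) := by
          apply mul_le_mul (by linarith) (by linarith) (by positivity) (by positivity)
  have b3 : ‖∫ t in ε..Real.pi,
      (((1 + (1 - ε)) / 2 / (ε ^ 2 + 4 * (1 - ε) * Real.sin (t / 2) ^ 2)) • E t -
        (1 / (4 * Real.sin (t / 2) ^ 2)) • E t)‖ ≤ Real.pi ^ 4 * (η + C * Real.pi * ε) := by
    have hci : ContinuousOn (fun t : ℝ => Real.pi ^ 4 * ε * η * (1 / t ^ 2))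
        (Set.uIcc ε Real.pi) := by
      apply ContinuousOn.mul continuousOn_const
      apply ContinuousOn.div continuousOn_const (by fun_prop)
      intro t ht
      rw [Set.uIcc_of_le hεπ] at ht
      have := hε.trans_le ht.1
      positivity
    have h := intervalIntegral.norm_integral_le_of_norm_le (μ := volume) hεπ
      (f := fun t => ((1 + (1 - ε)) / 2 / (ε ^ 2 + 4 * (1 - ε) * Real.sin (t / 2) ^ 2)) • E t -
        (1 / (4 * Real.sin (t / 2) ^ 2)) • E t)
      (g := fun t => Real.pi ^ 4 * ε * η * (1 / t ^ 2) + Real.pi ^ 4 * ε * C) ?_ ?_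
    · refine h.trans ?_
      rw [intervalIntegral.integral_add hci.intervalIntegrable intervalIntegrable_const,
        intervalIntegral.integral_const_mul, intervalIntegral.integral_const, smul_eq_mul]
      have h1 := integral_inv_sq_le hε hεπ
      calc _ ≤ Real.pi ^ 4 * ε * η * (1 / ε) + Real.pi * (Real.pi ^ 4 * ε * C) := by
            gcongr; linarith
        _ = _ := by field_simp
    · refine Eventually.of_forall fun t ht => ?_
      have ht0 : 0 < t := hε.trans ht.1
      rw [← sub_smul, norm_smul, Real.norm_eq_abs]
      calc _ ≤ Real.pi ^ 4 * ε / t ^ 3 * (η * t + C * t ^ 3) :=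
            mul_le_mul (kernel_sub_le hε hε2 ht.1.le ht.2) (hb t ⟨ht0.le, ht.2⟩) (norm_nonneg _)
              (by positivity)
        _ = _ := by field_simp
    · exact hci.intervalIntegrable.add intervalIntegrable_const
  calc _ ≤ ‖I1‖ + _ + _ := norm_add₃_le
    _ ≤ (η + C * Real.pi * ε) + Real.pi * (η + C * Real.pi * ε) +
        Real.pi ^ 4 * (η + C * Real.pi * ε) := by gcongr
    _ = _ := by ring

end HilbertKernel

/-! ### The Hilbert transform as a radial derivative at the boundary. -/

section RadialQuotient

local notation "𝔻" => Metric.ball (0 : ℂ) 1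
local notation "𝕋" => Metric.sphere (0 : ℂ) 1
local notation "conj" => starRingEnd _

theorem circleMap_zero_one (θ : ℝ) : circleMap 0 1 θ = Complex.exp (θ * Complex.I) := by
  simp [circleMap]

theorem onCircle_eq_circleMap (g : ℂ → ℂ) (θ : ℝ) : onCircle g θ = g (circleMap 0 1 θ) := by
  rw [circleMap_zero_one, onCircle]

theorem onCircle_periodic (g : ℂ → ℂ) : Function.Periodic (onCircle g) (2 * Real.pi) := by
  intro θ
  simp only [onCircle_eq_circleMap, periodic_circleMap 0 1 θ]

theorem exp_mem_circle (θ : ℝ) : Complex.exp (θ * Complex.I) ∈ 𝕋 := by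
  rw [mem_sphere_zero_iff_norm, Complex.norm_exp_ofReal_mul_I]

theorem real_mul_exp_mem_ball {r : ℝ} (h0 : 0 ≤ r) (h1 : r < 1) (θ : ℝ) :
    (r : ℂ) * Complex.exp (θ * Complex.I) ∈ 𝔻 := by
  rw [mem_ball_zero_iff, norm_mul, Complex.norm_exp_ofReal_mul_I, mul_one,
    Complex.norm_of_nonneg h0]
  exact h1

theorem poissonKernel_circleMap (r t : ℝ) :
    poissonKernel 0 (r : ℂ) (circleMap 0 1 t) =
      (1 - r ^ 2) / ((1 - r) ^ 2 + 4 * r * Real.sin (t / 2) ^ 2) := by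
  rw [poissonKernel_of_mem_circle (circleMap_mem_sphere 0 zero_le_one t), circleMap_zero_one]
  congr 1
  · simp
  · rw [← Complex.normSq_eq_norm_sq, Complex.normSq_apply]
    simp only [Complex.sub_re, Complex.sub_im, Complex.exp_ofReal_mul_I_re,
      Complex.exp_ofReal_mul_I_im, Complex.ofReal_re, Complex.ofReal_im, sub_zero]
    have h1 := Real.sin_sq_add_cos_sq t
    have h2 : Real.cos t = 1 - 2 * Real.sin (t / 2) ^ 2 := by
      rw [show t = 2 * (t / 2) by ring, Real.cos_two_mul, Real.cos_sq']; ring_nf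
    linear_combination h1 - 2 * r * h2

/-- The kernel is even in `t`, so folding the circle onto `[0, π]` produces second differences. -/
theorem sub_poissonIntegral_eq {g : ℂ → ℂ} (hg : Continuous (onCircle g)) {r : ℝ} (h0 : 0 ≤ r)
    (h1 : r < 1) (θ : ℝ) :
    onCircle g θ - poissonIntegral g (r * Complex.exp (θ * Complex.I)) =
      -((2 * Real.pi)⁻¹ • ∫ t in 0..Real.pi,
        ((1 - r ^ 2) / ((1 - r) ^ 2 + 4 * r * Real.sin (t / 2) ^ 2)) •
          symmDiff₂ (onCircle g) θ t) := by
  have hr : (r : ℂ) ∈ 𝔻 := by simpa [abs_of_nonneg h0] using h1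
  set F := onCircle g with hF
  set k : ℝ → ℝ := fun t => (1 - r ^ 2) / ((1 - r) ^ 2 + 4 * r * Real.sin (t / 2) ^ 2) with hk
  have hkc : Continuous k := by
    apply Continuous.div continuous_const (by fun_prop)
    intro t
    have : 0 < 1 - r := by linarith
    positivity
  have hshift : ∀ t : ℝ, g (Complex.exp (θ * Complex.I) * circleMap 0 1 t) = F (θ + t) := by
    intro t
    rw [hF, onCircle, circleMap_zero_one, ← Complex.exp_add]
    congr 2; push_cast; ring
  have hint : CircleIntegrable (fun ξ => g (Complex.exp (θ * Complex.I) * ξ)) 0 1 := by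
    rw [CircleIntegrable]
    simp only [hshift]
    exact (hg.comp (continuous_const.add continuous_id)).intervalIntegrable _ _
  have e1 : onCircle g θ - poissonIntegral g (r * Complex.exp (θ * Complex.I)) =
      -((2 * Real.pi)⁻¹ • ∫ t in 0..2 * Real.pi, k t • (F (θ + t) - F θ)) := by
    rw [mul_comm, poissonIntegral_rotate, ← poissonIntegral_const (onCircle g θ) hr, ← neg_sub,
      ← poissonIntegral_sub hint (circleIntegrable_const _ _ _) hr, poissonIntegral,
      Real.circleAverage]
    simp only [hshift, poissonKernel_circleMap, hk, hF]
  have hp : Function.Periodic (fun t => k t • (F (θ + t) - F θ)) (2 * Real.pi) := by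
    intro t
    have a1 : F (θ + (t + 2 * Real.pi)) = F (θ + t) := by
      rw [← add_assoc]; exact onCircle_periodic g _
    have a2 : k (t + 2 * Real.pi) = k t := by
      simp only [hk]
      rw [show (t + 2 * Real.pi) / 2 = t / 2 + Real.pi by ring, Real.sin_add_pi, neg_sq]
    simp only [a1, a2]
  have hc : Continuous fun t => k t • (F (θ + t) - F θ) :=
    hkc.fun_smul ((hg.comp (continuous_const.add continuous_id)).sub continuous_const)
  have e2 := hp.intervalIntegral_add_eq 0 (-Real.pi)
  rw [zero_add, show -Real.pi + 2 * Real.pi = Real.pi by ring,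
    ← intervalIntegral.integral_add_adjacent_intervals (hc.intervalIntegrable (-Real.pi) 0)
      (hc.intervalIntegrable 0 Real.pi)] at e2
  have e3 : ∫ t in (-Real.pi)..0, k t • (F (θ + t) - F θ) =
      ∫ t in 0..Real.pi, k t • (F (θ - t) - F θ) := by
    have := intervalIntegral.integral_comp_neg (a := 0) (b := Real.pi)
      (fun t => k t • (F (θ + t) - F θ))
    rw [neg_zero] at this
    rw [← this]
    congr 1; ext t
    have : k (-t) = k t := by simp only [hk, neg_div, Real.sin_neg, neg_sq]
    simp only [this, sub_eq_add_neg]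
  have hc' : Continuous fun t => k t • (F (θ - t) - F θ) :=
    hkc.fun_smul ((hg.comp (continuous_const.sub continuous_id)).sub continuous_const)
  rw [e1, e2, e3, ← intervalIntegral.integral_add (hc'.intervalIntegrable _ _)
    (hc.intervalIntegrable _ _)]
  congr 3; ext t
  rw [← smul_add, symmDiff₂]
  congr 1; ring

/-- The radial difference quotient at the boundary of the Poisson integral. -/
noncomputable def radialQuotient (g : ℂ → ℂ) (θ ε : ℝ) : ℂ :=
  (onCircle g θ - poissonIntegral g (((1 - ε : ℝ) : ℂ) * Complex.exp (θ * Complex.I))) / ε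

theorem radialQuotient_eq {g : ℂ → ℂ} (hg : Continuous (onCircle g)) {ε : ℝ} (h0 : 0 < ε)
    (h1 : ε ≤ 1) (θ : ℝ) :
    radialQuotient g θ ε = -(1 / (Real.pi : ℂ)) * ∫ t in 0..Real.pi,
        ((1 + (1 - ε)) / 2 / (ε ^ 2 + 4 * (1 - ε) * Real.sin (t / 2) ^ 2)) •
          symmDiff₂ (onCircle g) θ t := by
  rw [radialQuotient, sub_poissonIntegral_eq hg (by linarith) (by linarith)]
  have : ∀ t, ((1 - (1 - ε) ^ 2) / ((1 - (1 - ε)) ^ 2 + 4 * (1 - ε) * Real.sin (t / 2) ^ 2)) •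
      symmDiff₂ (onCircle g) θ t = (2 * ε) •
      (((1 + (1 - ε)) / 2 / (ε ^ 2 + 4 * (1 - ε) * Real.sin (t / 2) ^ 2)) •
          symmDiff₂ (onCircle g) θ t) := by
    intro t
    rw [smul_smul]
    congr 1
    rw [show 1 - (1 - ε) = ε by ring]
    ring
  simp only [this, intervalIntegral.integral_smul]
  have hpi : (Real.pi : ℂ) ≠ 0 := by exact_mod_cast Real.pi_ne_zero
  have hε : (ε : ℂ) ≠ 0 := by exact_mod_cast h0.ne'
  simp only [Complex.real_smul]
  push_cast
  field_simp

theorem tendsto_radialQuotient_sub_truncatedHilbert {g : ℂ → ℂ}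
    (hg : Differentiable ℝ (onCircle g)) {M : ℝ} (hM : ∀ x, ‖deriv (onCircle g) x‖ ≤ M) (θ : ℝ) :
    Tendsto (fun ε => radialQuotient g θ ε - truncatedHilbert (deriv (onCircle g)) θ ε)
      (𝓝[>] 0) (𝓝 0) := by
  rw [Metric.tendsto_nhds]
  intro δ hδ
  have hpi3 := Real.pi_gt_three
  set K := 1 + Real.pi + Real.pi ^ 4 with hK
  have hK0 : 0 < K := by positivity
  -- With this `η` the final bound tends to `δ / 2` as `ε → 0`.
  obtain ⟨C, hC, hE⟩ := exists_norm_symmDiff₂_le hg θ (η := δ / (2 * K)) (by positivity)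
  have hlim : Tendsto (fun ε : ℝ => K * (δ / (2 * K) + C * Real.pi * ε)) (𝓝[>] 0)
      (𝓝 (δ / 2)) := by
    have : Continuous (fun ε : ℝ => K * (δ / (2 * K) + C * Real.pi * ε)) := by fun_prop
    have h := (this.tendsto 0).mono_left (nhdsWithin_le_nhds (s := Set.Ioi 0))
    have e : K * (δ / (2 * K) + C * Real.pi * 0) = δ / 2 := by field_simp; ring
    rwa [e] at h
  filter_upwards [Ioc_mem_nhdsGT (show (0 : ℝ) < 1 / 2 by norm_num),
    hlim.eventually_lt_const (half_lt_self hδ)] with ε hε hlt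
  rw [dist_zero_right, radialQuotient_eq hg.continuous hε.1 (by linarith [hε.2]),
    truncatedHilbert_deriv_eq hg hM θ hε.1 (by linarith [hε.2]), ← mul_sub, norm_mul]
  have h1 : ‖-(1 / (Real.pi : ℂ))‖ ≤ 1 := by
    rw [norm_neg, norm_div, norm_one, Complex.norm_of_nonneg Real.pi_pos.le,
      div_le_one Real.pi_pos]
    linarith
  have h2 := norm_integral_kernel_sub_le (continuous_symmDiff₂ hg.continuous θ) (by positivity)
    hC hE hε.1 hε.2
  exact ((mul_le_of_le_one_left (norm_nonneg _) h1).trans h2).trans_lt hlt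

theorem hasHilbertTransformAt_deriv_iff {g : ℂ → ℂ} (hg : Differentiable ℝ (onCircle g)) {M : ℝ}
    (hM : ∀ x, ‖deriv (onCircle g) x‖ ≤ M) (θ : ℝ) (l : ℂ) :
    HasHilbertTransformAt (deriv (onCircle g)) θ l ↔
      Tendsto (radialQuotient g θ) (𝓝[>] 0) (𝓝 l) := by
  have h := tendsto_radialQuotient_sub_truncatedHilbert hg hM θ
  constructor
  · intro hl
    simpa using h.add hl
  · intro hl
    have := hl.sub h
    simpa [HasHilbertTransformAt] using this

end RadialQuotient

/-! ### Radial derivatives of Lipschitz analytic functions. -/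

section RadialLimits

local notation "𝔻" => Metric.ball (0 : ℂ) 1
local notation "𝕋" => Metric.sphere (0 : ℂ) 1
local notation "conj" => starRingEnd _

theorem tendsto_radial {ζ : ℂ} (hζ : ζ ∈ 𝕋) :
    Tendsto (fun ε : ℝ => ((1 - ε : ℝ) : ℂ) * ζ) (𝓝[>] 0) (𝓝[𝔻] ζ) := by
  rw [tendsto_nhdsWithin_iff]
  constructor
  · have : Continuous (fun ε : ℝ => ((1 - ε : ℝ) : ℂ) * ζ) := by fun_prop
    have h := (this.tendsto 0).mono_left (nhdsWithin_le_nhds (s := Set.Ioi 0))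
    simpa using h
  · filter_upwards [Ioo_mem_nhdsGT (zero_lt_one (α := ℝ))] with ε hε
    rw [mem_sphere_zero_iff_norm] at hζ
    rw [mem_ball_zero_iff, norm_mul, hζ, mul_one, Complex.norm_of_nonneg (by linarith [hε.2])]
    linarith [hε.1]

theorem tendsto_div_sub_of_hasDerivAt {f : ℂ → ℂ} {θ₀ : ℝ} {d : ℂ}
    (hd : HasDerivAt (onCircle f) d θ₀) :
    Tendsto (fun z => (f z - f (Complex.exp (θ₀ * Complex.I))) /
        (z - Complex.exp (θ₀ * Complex.I)))
      (𝓝[𝕋 \ {Complex.exp (θ₀ * Complex.I)}] (Complex.exp (θ₀ * Complex.I)))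
      (𝓝 (d / (Complex.exp (θ₀ * Complex.I) * Complex.I))) := by
  set ζ := Complex.exp (θ₀ * Complex.I) with hζ
  have hζ0 : ζ ≠ 0 := Complex.exp_ne_zero _
  have hexp : HasDerivAt (fun s : ℝ => Complex.exp (s * Complex.I)) (ζ * Complex.I) θ₀ := by
    have h1 : HasDerivAt (fun s : ℝ => (s : ℂ) * Complex.I) Complex.I θ₀ := by
      simpa using (Complex.ofRealCLM.hasDerivAt (x := θ₀)).mul_const Complex.I
    exact h1.cexp
  have hratio : Tendsto (fun s : ℝ => slope (onCircle f) θ₀ s /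
      slope (fun s : ℝ => Complex.exp (s * Complex.I)) θ₀ s) (𝓝[≠] θ₀)
      (𝓝 (d / (ζ * Complex.I))) :=
    (hasDerivAt_iff_tendsto_slope.1 hd).div (hasDerivAt_iff_tendsto_slope.1 hexp)
      (mul_ne_zero hζ0 Complex.I_ne_zero)
  -- A right inverse of `s ↦ e^{is}` on the circle, continuous at `ζ` because `arg` is continuous at
  -- `1`.
  set σ : ℂ → ℝ := fun z => θ₀ + Complex.arg (z / ζ) with hσ
  have hσexp : ∀ z ∈ 𝕋, Complex.exp (σ z * Complex.I) = z := by
    intro z hz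
    have hn : ‖z / ζ‖ = 1 := by
      rw [mem_sphere_zero_iff_norm] at hz
      rw [norm_div, hz, hζ, Complex.norm_exp_ofReal_mul_I, div_one]
    have h2 := Complex.norm_mul_exp_arg_mul_I (z / ζ)
    rw [hn, Complex.ofReal_one, one_mul] at h2
    rw [hσ]
    push_cast
    rw [add_mul, Complex.exp_add, h2, ← hζ, mul_div_cancel₀ _ hζ0]
  have hσt : Tendsto σ (𝓝[𝕋 \ {ζ}] ζ) (𝓝[≠] θ₀) := by
    rw [tendsto_nhdsWithin_iff]
    constructor
    · have h1 : ContinuousAt σ ζ := by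
        apply continuousAt_const.add
        apply ContinuousAt.comp (g := Complex.arg)
        · rw [div_self hζ0]
          exact Complex.continuousAt_arg (by simp)
        · exact continuousAt_id.div_const ζ
      have h2 : σ ζ = θ₀ := by simp [hσ, div_self hζ0]
      have := h1.tendsto
      rw [h2] at this
      exact this.mono_left nhdsWithin_le_nhds
    · filter_upwards [self_mem_nhdsWithin] with z hz heq
      apply hz.2
      rw [Set.mem_singleton_iff, ← hσexp z hz.1, heq]
  refine (hratio.comp hσt).congr' ?_
  filter_upwards [self_mem_nhdsWithin, hσt.eventually self_mem_nhdsWithin] with z hz hne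
  have hne' : ((σ z : ℂ) - θ₀) ≠ 0 := by
    rw [sub_ne_zero]; exact_mod_cast hne
  simp only [Function.comp_apply, slope, vsub_eq_sub, onCircle, hσexp z hz.1, Complex.real_smul,
    ← hζ]
  push_cast
  rw [mul_div_mul_left _ _ (inv_ne_zero hne')]

theorem ae_circleMap_ne (ζ : ℂ) : ∀ᵐ θ : ℝ, circleMap 0 1 θ ≠ ζ := by
  by_cases h : ∃ θ₀ : ℝ, circleMap 0 1 θ₀ = ζ
  · obtain ⟨θ₀, rfl⟩ := h
    have hsub : {θ : ℝ | ¬ circleMap 0 1 θ ≠ circleMap 0 1 θ₀} ⊆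
        Set.range fun n : ℤ => θ₀ + n * (2 * Real.pi) := by
      intro θ hθ
      simp only [Set.mem_ofPred_eq, not_not, circleMap_zero_one] at hθ
      obtain ⟨n, hn⟩ := Complex.exp_eq_exp_iff_exists_int.1 hθ
      refine ⟨n, ?_⟩
      have h2 : (θ : ℂ) = θ₀ + n * (2 * Real.pi) := by
        apply mul_right_cancel₀ Complex.I_ne_zero
        rw [hn]; ring
      exact_mod_cast h2.symm
    exact ((Set.countable_range _).mono hsub).measure_zero _
  · push Not at h
    exact Eventually.of_forall h

/-- The quotient `(f z - f ζ) / (z - ζ)` is bounded and analytic in the disk, hence the Poisson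
integral of its boundary values. Differentiability along the circle makes these continuous at `ζ`,
so the quotient has a limit there from inside. -/
theorem exists_tendsto_radial_of_hasDerivAt {f : ℂ → ℂ} (hf : DifferentiableOn ℂ f 𝔻) {K : NNReal}
    (hK : LipschitzWith K f) {θ₀ : ℝ} (hd : DifferentiableAt ℝ (onCircle f) θ₀) :
    ∃ l, Tendsto (fun ε : ℝ => (f (Complex.exp (θ₀ * Complex.I)) -
      f (((1 - ε : ℝ) : ℂ) * Complex.exp (θ₀ * Complex.I))) / ε) (𝓝[>] 0) (𝓝 l) := by
  have hlim := tendsto_div_sub_of_hasDerivAt hd.hasDerivAt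
  set ζ := Complex.exp (θ₀ * Complex.I) with hζ
  set c := deriv (onCircle f) θ₀ / (ζ * Complex.I) with hc
  have hζ0 : ζ ≠ 0 := Complex.exp_ne_zero _
  have hζT : ζ ∈ 𝕋 := exp_mem_circle θ₀
  have hζn : ‖ζ‖ = 1 := mem_sphere_zero_iff_norm.1 hζT
  set q : ℂ → ℂ := fun z => (f z - f ζ) / (z - ζ) with hq
  have hqK : ∀ z, ‖q z‖ ≤ K := by
    intro z
    rw [hq, norm_div]
    apply div_le_of_le_mul₀ (norm_nonneg _) K.coe_nonneg
    simpa [dist_eq_norm] using hK.dist_le_mul z ζ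
  have hqm : Measurable q := by
    have := hK.continuous.measurable
    fun_prop
  -- Division by zero gives `q ζ = 0`; the value `c` restores continuity along the circle and leaves
  -- the integrals unchanged.
  set Q := Function.update q ζ c with hQ
  have hQne : ∀ z, z ≠ ζ → Q z = q z := fun z hz => Function.update_of_ne hz _ _
  have hQm : Measurable Q := by
    classical
    have : Q = fun z => if z = ζ then c else q z := by
      ext z; simp [hQ, Function.update_apply]
    rw [this]
    exact Measurable.ite (measurableSet_singleton ζ) measurable_const hqm
  have hQb : ∀ z, ‖Q z‖ ≤ max (K : ℝ) ‖c‖ := by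
    intro z
    by_cases hz : z = ζ
    · rw [hz, hQ, Function.update_self]; exact le_max_right _ _
    · rw [hQne z hz]; exact (hqK z).trans (le_max_left _ _)
  have hQi : CircleIntegrable Q 0 1 :=
    (intervalIntegrable_const (c := max (K : ℝ) ‖c‖)).mono_fun'
      (hQm.comp (measurable_circleMap 0 1)).aestronglyMeasurable
      (Eventually.of_forall fun _ => hQb _)
  have hQc : ContinuousWithinAt Q 𝕋 ζ := continuousWithinAt_update_same.2 hlim
  -- The dilates of `q` are analytic across the circle, so the Poisson formula applies to them and
  -- passes to the limit by domination.
  have hQP : ∀ w ∈ 𝔻, poissonIntegral Q w = q w := by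
    intro w hw
    obtain ⟨C, hC0, hC⟩ := exists_poissonKernel_le hw
    have hscale : ∀ z : ℂ, Tendsto (fun s : ℝ => ((1 - s : ℝ) : ℂ) * z) (𝓝[>] 0) (𝓝 z) := by
      intro z
      have : Continuous (fun s : ℝ => ((1 - s : ℝ) : ℂ) * z) := by fun_prop
      have h := (this.tendsto 0).mono_left (nhdsWithin_le_nhds (s := Set.Ioi 0))
      simpa using h
    have hqc : ∀ z, z ≠ ζ → Tendsto (fun s : ℝ => q (((1 - s : ℝ) : ℂ) * z)) (𝓝[>] 0)
        (𝓝 (q z)) := by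
      intro z hz
      have : ContinuousAt q z :=
        (hK.continuous.continuousAt.sub continuousAt_const).div
          (continuousAt_id.sub continuousAt_const) (sub_ne_zero.2 hz)
      exact this.tendsto.comp (hscale z)
    have hdc : ∀ᶠ s : ℝ in 𝓝[>] 0,
        DiffContOnCl ℂ (fun z => q (((1 - s : ℝ) : ℂ) * z)) 𝔻 := by
      filter_upwards [Ioo_mem_nhdsGT (zero_lt_one (α := ℝ))] with s hs
      apply DifferentiableOn.diffContOnCl
      rw [closure_ball _ one_ne_zero]
      intro z hz
      apply DifferentiableAt.differentiableWithinAt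
      rw [mem_closedBall_zero_iff] at hz
      have hsz : ‖((1 - s : ℝ) : ℂ) * z‖ < 1 := by
        rw [norm_mul, Complex.norm_of_nonneg (by linarith [hs.2])]
        nlinarith [hs.1, hs.2, norm_nonneg z]
      have h1 : DifferentiableAt ℂ (fun z => ((1 - s : ℝ) : ℂ) * z) z := by fun_prop
      have h2 : DifferentiableAt ℂ f (((1 - s : ℝ) : ℂ) * z) :=
        hf.differentiableAt (Metric.isOpen_ball.mem_nhds (mem_ball_zero_iff.2 hsz))
      have h3 : ((1 - s : ℝ) : ℂ) * z - ζ ≠ 0 := by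
        intro h
        rw [sub_eq_zero] at h
        rw [h, hζn] at hsz
        exact lt_irrefl _ hsz
      exact ((h2.comp z h1).sub_const _).div (h1.sub_const _) h3
    have hwζ : w ≠ ζ := by
      rintro rfl
      rw [mem_ball_zero_iff, hζn] at hw
      exact lt_irrefl _ hw
    have t1 : Tendsto (fun s : ℝ => Real.circleAverage
        (fun ξ => poissonKernel 0 w ξ • q (((1 - s : ℝ) : ℂ) * ξ)) 0 1) (𝓝[>] 0)
        (𝓝 (poissonIntegral Q w)) := by
      apply tendsto_circleAverage_of_dominated (C := C * K)
      · filter_upwards [hdc] with s hs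
        apply CircleIntegrable.poissonKernel_smul _ hw
        exact (hs.continuousOn_ball.mono Metric.sphere_subset_closedBall).circleIntegrable
          zero_le_one
      · refine Eventually.of_forall fun s ξ hξ => ?_
        rw [norm_smul, Real.norm_of_nonneg (poissonKernel_nonneg hw hξ)]
        exact mul_le_mul (hC ξ hξ) (hqK _) (norm_nonneg _) hC0.le
      · filter_upwards [ae_restrict_of_ae (ae_circleMap_ne ζ)] with θ hθ
        rw [hQne _ hθ]
        exact (hqc _ hθ).const_smul _
    have t2 : Tendsto (fun s : ℝ => Real.circleAverage
        (fun ξ => poissonKernel 0 w ξ • q (((1 - s : ℝ) : ℂ) * ξ)) 0 1) (𝓝[>] 0) (𝓝 (q w)) := by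
      refine (hqc w hwζ).congr' ?_
      filter_upwards [hdc] with s hs
      exact (hs.circleAverage_poissonKernel_smul hw).symm
    exact tendsto_nhds_unique t1 t2
  have hT := (tendsto_poissonIntegral hQi (fun ξ _ => hQb ξ) hζT hQc).comp (tendsto_radial hζT)
  rw [hQ, Function.update_self] at hT
  refine ⟨c * ζ, (hT.mul_const ζ).congr' ?_⟩
  filter_upwards [(tendsto_radial hζT).eventually self_mem_nhdsWithin, self_mem_nhdsWithin]
    with ε hε hε0
  have hε0' : (ε : ℂ) ≠ 0 := by exact_mod_cast (ne_of_gt hε0)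
  rw [Function.comp_apply, ← hQ, hQP _ hε, hq]
  have e1 : ((1 - ε : ℝ) : ℂ) * ζ - ζ = -(ε * ζ) := by push_cast; ring
  simp only [e1]
  field_simp
  ring

theorem exists_lipschitz_extension_radial {a : ℂ → ℂ} (ha : DifferentiableOn ℂ a 𝔻) {K : NNReal}
    (hK : LipschitzOnWith K a 𝔻) :
    ∃ f : ℂ → ℂ, Continuous f ∧ Set.EqOn a f 𝔻 ∧ ∀ᵐ θ : ℝ, ∃ l,
      Tendsto (fun ε : ℝ => (f (Complex.exp (θ * Complex.I)) -
        a (((1 - ε : ℝ) : ℂ) * Complex.exp (θ * Complex.I))) / ε) (𝓝[>] 0) (𝓝 l) := by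
  obtain ⟨f, hf, haf⟩ := hK.extend_finite_dimension
  refine ⟨f, hf.continuous, haf, ?_⟩
  have hcirc : LipschitzWith (lipschitzExtensionConstant ℂ * K) (onCircle f) := by
    have : onCircle f = f ∘ circleMap 0 1 := funext (onCircle_eq_circleMap f)
    rw [this]
    simpa using hf.comp (lipschitzWith_circleMap 0 1)
  filter_upwards [hcirc.ae_differentiableAt_real] with θ hθ
  obtain ⟨l, hl⟩ := exists_tendsto_radial_of_hasDerivAt (ha.congr fun z hz => (haf hz).symm) hf hθ
  refine ⟨l, hl.congr' ?_⟩
  filter_upwards [(tendsto_radial (exp_mem_circle θ)).eventually self_mem_nhdsWithin] with ε hε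
  rw [haf hε]

end RadialLimits

/-! ### Lipschitz Poisson integrals have bounded boundary derivative and Hilbert transform. -/

section LipschitzToHilbert

local notation "𝔻" => Metric.ball (0 : ℂ) 1
local notation "𝕋" => Metric.sphere (0 : ℂ) 1
local notation "conj" => starRingEnd _

theorem hasFDerivAt_add_conj {a b : ℂ → ℂ} {a' b' z : ℂ} (ha : HasDerivAt a a' z)
    (hb : HasDerivAt b b' z) :
    ∃ D : ℂ →L[ℝ] ℂ, HasFDerivAt (fun z => a z + conj (b z)) D z ∧
      ∀ v, D v = a' * v + conj (b' * v) := by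
  have h1 := ha.hasFDerivAt.restrictScalars ℝ
  have h2 := Complex.conjCLE.toContinuousLinearMap.hasFDerivAt.comp z
    (hb.hasFDerivAt.restrictScalars ℝ)
  refine ⟨_, h1.add h2, fun v => ?_⟩
  simp [mul_comm]

/-- The real derivative in the directions `1` and `I` bounds `a' + conj b'` and `a' - conj b'`. -/
theorem norm_deriv_le_of_lipschitzOnWith_add_conj {a b : ℂ → ℂ} {L : NNReal}
    (hL : LipschitzOnWith L (fun z => a z + conj (b z)) 𝔻) {a' b' z : ℂ} (hz : z ∈ 𝔻)
    (ha : HasDerivAt a a' z) (hb : HasDerivAt b b' z) : ‖a'‖ ≤ L ∧ ‖b'‖ ≤ L := by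
  obtain ⟨D, hD, hDv⟩ := hasFDerivAt_add_conj ha hb
  have hn := hD.le_of_lipschitzOn (Metric.isOpen_ball.mem_nhds hz) hL
  have h1 : ‖a' + conj b'‖ ≤ L := by
    have := D.le_of_opNorm_le hn 1
    rw [hDv] at this
    simpa using this
  have h2 : ‖a' - conj b'‖ ≤ L := by
    have := D.le_of_opNorm_le hn Complex.I
    rw [hDv, map_mul, Complex.conj_I, mul_neg, ← sub_eq_add_neg, ← sub_mul] at this
    simpa using this
  constructor
  · have h3 : 2 * a' = (a' + conj b') + (a' - conj b') := by ring
    have h4 : ‖2 * a'‖ ≤ L + L := by rw [h3]; exact norm_add_le_of_le h1 h2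
    rw [norm_mul, Complex.norm_ofNat] at h4
    linarith
  · have h3 : 2 * conj b' = (a' + conj b') - (a' - conj b') := by ring
    have h4 : ‖2 * conj b'‖ ≤ L + L := by rw [h3]; exact norm_sub_le_of_le h1 h2
    rw [norm_mul, Complex.norm_ofNat, RCLike.norm_conj] at h4
    linarith

variable {g : ℂ → ℂ}

theorem circleIntegrable_of_continuousOn_circle (hgc : ContinuousOn g 𝕋) :
    CircleIntegrable g 0 1 :=
  hgc.circleIntegrable zero_le_one

theorem tendsto_poissonIntegral_of_continuousOn (hgc : ContinuousOn g 𝕋) {ζ : ℂ} (hζ : ζ ∈ 𝕋) :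
    Tendsto (poissonIntegral g) (𝓝[𝔻] ζ) (𝓝 (g ζ)) := by
  obtain ⟨C, hC⟩ := (isCompact_sphere (0 : ℂ) 1).exists_bound_of_continuousOn hgc
  exact tendsto_poissonIntegral (circleIntegrable_of_continuousOn_circle hgc) hC hζ (hgc ζ hζ)

/-- The point `ξ` may lie on the circle or inside: the first case bounds the tangential derivative,
the second the radial quotient. -/
theorem dist_le_of_lipschitzOnWith_poissonIntegral (hgc : ContinuousOn g 𝕋) {L : NNReal}
    (hL : LipschitzOnWith L (poissonIntegral g) 𝔻) {ζ ξ : ℂ} (hζ : ζ ∈ 𝕋) (hξ : ξ ∈ closure 𝔻)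
    {y : ℂ} (hy : Tendsto (poissonIntegral g) (𝓝[𝔻] ξ) (𝓝 y)) :
    dist (g ζ) y ≤ L * dist ζ ξ := by
  have : (𝓝[𝔻] ζ).NeBot := by
    apply mem_closure_iff_nhdsWithin_neBot.1
    rw [closure_ball _ one_ne_zero]
    exact Metric.sphere_subset_closedBall hζ
  have : (𝓝[𝔻] ξ).NeBot := mem_closure_iff_nhdsWithin_neBot.1 hξ
  have h1 := (tendsto_poissonIntegral_of_continuousOn hgc hζ).comp
    (tendsto_fst (f := 𝓝[𝔻] ζ) (g := 𝓝[𝔻] ξ))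
  have h2 := hy.comp (tendsto_snd (f := 𝓝[𝔻] ζ) (g := 𝓝[𝔻] ξ))
  have h3 : Tendsto (fun p : ℂ × ℂ => L * dist p.1 p.2) (𝓝[𝔻] ζ ×ˢ 𝓝[𝔻] ξ)
      (𝓝 (L * dist ζ ξ)) := by
    have : Continuous fun p : ℂ × ℂ => (L : ℝ) * dist p.1 p.2 := by fun_prop
    refine (this.tendsto (ζ, ξ)).mono_left ?_
    rw [nhds_prod_eq]
    exact Filter.prod_mono nhdsWithin_le_nhds nhdsWithin_le_nhds
  refine le_of_tendsto_of_tendsto (h1.dist h2) h3 ?_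
  filter_upwards [prod_mem_prod self_mem_nhdsWithin self_mem_nhdsWithin] with p hp
  exact hL.dist_le_mul _ hp.1 _ hp.2

theorem norm_deriv_onCircle_le_of_lipschitzOnWith (hgc : ContinuousOn g 𝕋) {L : NNReal}
    (hL : LipschitzOnWith L (poissonIntegral g) 𝔻) (x : ℝ) : ‖deriv (onCircle g) x‖ ≤ L := by
  apply norm_deriv_le_of_lipschitz (C := L)
  apply LipschitzWith.of_dist_le_mul
  intro s t
  rw [onCircle_eq_circleMap, onCircle_eq_circleMap]
  have h1 := circleMap_mem_sphere 0 zero_le_one s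
  have h2 := circleMap_mem_sphere 0 zero_le_one t
  have h3 : circleMap 0 1 t ∈ closure 𝔻 := by
    rw [closure_ball _ one_ne_zero]; exact Metric.sphere_subset_closedBall h2
  refine (dist_le_of_lipschitzOnWith_poissonIntegral hgc hL h1 h3
    (tendsto_poissonIntegral_of_continuousOn hgc h2)).trans ?_
  gcongr
  simpa using (lipschitzWith_circleMap 0 1).dist_le_mul s t

theorem norm_radialQuotient_le (hgc : ContinuousOn g 𝕋) {L : NNReal}
    (hL : LipschitzOnWith L (poissonIntegral g) 𝔻) {θ ε : ℝ} (h0 : 0 < ε) (h1 : ε ≤ 1) :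
    ‖radialQuotient g θ ε‖ ≤ L := by
  have hw := real_mul_exp_mem_ball (r := 1 - ε) (by linarith) (by linarith) θ
  have hcont : Tendsto (poissonIntegral g)
      (𝓝[𝔻] (((1 - ε : ℝ) : ℂ) * Complex.exp (θ * Complex.I))) (𝓝 _) :=
    hL.continuousOn _ hw
  have h2 := dist_le_of_lipschitzOnWith_poissonIntegral hgc hL (exp_mem_circle θ)
    (subset_closure hw) hcont
  rw [radialQuotient, norm_div, Complex.norm_of_nonneg h0.le, div_le_iff₀ h0, onCircle,
    ← dist_eq_norm]
  refine h2.trans_eq ?_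
  rw [dist_eq_norm]
  have : Complex.exp (θ * Complex.I) - ((1 - ε : ℝ) : ℂ) * Complex.exp (θ * Complex.I) =
      ε * Complex.exp (θ * Complex.I) := by push_cast; ring
  rw [this, norm_mul, Complex.norm_exp_ofReal_mul_I, Complex.norm_of_nonneg h0.le, mul_one]

theorem continuous_radialQuotient (hg : Continuous (onCircle g)) (hgi : CircleIntegrable g 0 1)
    {ε : ℝ} (h0 : 0 < ε) (h1 : ε ≤ 1) : Continuous fun θ => radialQuotient g θ ε := by
  unfold radialQuotient
  apply Continuous.div_const
  apply hg.sub
  apply (harmonicOnNhd_poissonIntegral hgi).continuousOn.comp_continuous (by fun_prop)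
  exact fun θ => real_mul_exp_mem_ball (by linarith) (by linarith) θ

theorem ae_exists_tendsto_radialQuotient (hgc : ContinuousOn g 𝕋) {L : NNReal}
    (hL : LipschitzOnWith L (poissonIntegral g) 𝔻) :
    ∀ᵐ θ : ℝ, ∃ l, Tendsto (radialQuotient g θ) (𝓝[>] 0) (𝓝 l) := by
  have hgi := circleIntegrable_of_continuousOn_circle hgc
  set a := herglotzPart g with ha
  set b := herglotzPart (fun ξ => conj (g ξ)) with hb
  have haA : DifferentiableOn ℂ a 𝔻 := (analyticOnNhd_herglotzPart hgi).differentiableOn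
  have hbA : DifferentiableOn ℂ b 𝔻 := (analyticOnNhd_herglotzPart hgi.conj_comp).differentiableOn
  have hu : ∀ z ∈ 𝔻, poissonIntegral g z = a z + conj (b z) := fun z hz =>
    poissonIntegral_eq_add_conj hgi hz
  have hL' : LipschitzOnWith L (fun z => a z + conj (b z)) 𝔻 := by
    intro z hz w hw
    have := hL hz hw
    rwa [hu z hz, hu w hw] at this
  have hd : ∀ c : ℂ → ℂ, DifferentiableOn ℂ c 𝔻 → ∀ z ∈ 𝔻, HasDerivAt c (deriv c z) z :=
    fun c hc z hz => (hc.differentiableAt (Metric.isOpen_ball.mem_nhds hz)).hasDerivAt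
  have hbound := fun z (hz : z ∈ 𝔻) =>
    norm_deriv_le_of_lipschitzOnWith_add_conj hL' hz (hd a haA z hz) (hd b hbA z hz)
  have haL : LipschitzOnWith L a 𝔻 := (convex_ball 0 1).lipschitzOnWith_of_nnnorm_deriv_le
    (fun z hz => (hd a haA z hz).differentiableAt) (fun z hz => (hbound z hz).1)
  have hbL : LipschitzOnWith L b 𝔻 := (convex_ball 0 1).lipschitzOnWith_of_nnnorm_deriv_le
    (fun z hz => (hd b hbA z hz).differentiableAt) (fun z hz => (hbound z hz).2)
  obtain ⟨fa, hfac, hfa, hfal⟩ := exists_lipschitz_extension_radial haA haL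
  obtain ⟨fb, hfbc, hfb, hfbl⟩ := exists_lipschitz_extension_radial hbA hbL
  have hF : ∀ θ : ℝ, onCircle g θ =
      fa (Complex.exp (θ * Complex.I)) + conj (fb (Complex.exp (θ * Complex.I))) := by
    intro θ
    have h1 := (tendsto_poissonIntegral_of_continuousOn hgc (exp_mem_circle θ)).comp
      (tendsto_radial (exp_mem_circle θ))
    have hc : Continuous fun z => fa z + conj (fb z) := by fun_prop
    have h2 := ((hc.tendsto (Complex.exp (θ * Complex.I))).mono_left nhdsWithin_le_nhds).comp
      (tendsto_radial (exp_mem_circle θ))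
    refine tendsto_nhds_unique h1 (h2.congr' ?_)
    filter_upwards [(tendsto_radial (exp_mem_circle θ)).eventually self_mem_nhdsWithin] with ε hε
    simp only [Function.comp_apply]
    rw [hu _ hε, hfa hε, hfb hε]
  filter_upwards [hfal, hfbl] with θ ⟨la, hla⟩ ⟨lb, hlb⟩
  have hlb' := (Complex.continuous_conj.tendsto lb).comp hlb
  refine ⟨la + conj lb, (hla.add hlb').congr' ?_⟩
  filter_upwards [(tendsto_radial (exp_mem_circle θ)).eventually self_mem_nhdsWithin] with ε hε
  rw [radialQuotient, hF, hu _ hε]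
  simp only [Function.comp_apply, map_div₀, map_sub, Complex.conj_ofReal]
  ring

theorem memLinfty_of_lipschitzOnWith_poissonIntegral (hgc : ContinuousOn g 𝕋)
    (hg : Differentiable ℝ (onCircle g)) {L : NNReal}
    (hL : LipschitzOnWith L (poissonIntegral g) 𝔻) :
    MemLinftyCircle (deriv (onCircle g)) ∧ HilbertTransformMemLinfty (deriv (onCircle g)) := by
  classical
  have hM := norm_deriv_onCircle_le_of_lipschitzOnWith hgc hL
  refine ⟨memLp_top_of_bound (measurable_deriv _).aestronglyMeasurable L
    (Eventually.of_forall hM), ?_⟩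
  set h : ℝ → ℂ := fun θ => if H : ∃ l, Tendsto (radialQuotient g θ) (𝓝[>] 0) (𝓝 l) then H.choose
    else 0 with hh
  have hlim : ∀ᵐ θ : ℝ, Tendsto (radialQuotient g θ) (𝓝[>] 0) (𝓝 (h θ)) := by
    filter_upwards [ae_exists_tendsto_radialQuotient hgc hL] with θ hθ
    simp only [hh, dif_pos hθ]
    exact hθ.choose_spec
  -- A countable sequence of radii makes the chosen limit `h` a.e. strongly measurable.
  have hseq : Tendsto (fun n : ℕ => 1 / ((n : ℝ) + 1)) atTop (𝓝[>] 0) := by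
    rw [tendsto_nhdsWithin_iff]
    exact ⟨tendsto_one_div_add_atTop_nhds_zero_nat,
      Eventually.of_forall fun n => Set.mem_Ioi.2 Nat.one_div_pos_of_nat⟩
  have hmeas : AEStronglyMeasurable h volume :=
    aestronglyMeasurable_of_tendsto_ae atTop
      (f := fun (n : ℕ) θ => radialQuotient g θ (1 / ((n : ℝ) + 1)))
      (fun n => (continuous_radialQuotient hg.continuous
        (circleIntegrable_of_continuousOn_circle hgc) Nat.one_div_pos_of_nat
        (by rw [div_le_one (by positivity)]; linarith [Nat.cast_nonneg (α := ℝ) n])).aestronglyMeasurable)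
      (hlim.mono fun θ hθ => hθ.comp hseq)
  have hbd : ∀ᵐ θ : ℝ, ‖h θ‖ ≤ L := by
    filter_upwards [hlim] with θ hθ
    apply le_of_tendsto hθ.norm
    filter_upwards [Ioc_mem_nhdsGT (zero_lt_one (α := ℝ))] with ε hε
    exact norm_radialQuotient_le hgc hL hε.1 hε.2
  refine ⟨h, memLp_top_of_bound hmeas.restrict L (ae_restrict_of_ae hbd), ae_restrict_of_ae ?_⟩
  filter_upwards [hlim] with θ hθ
  exact (hasHilbertTransformAt_deriv_iff hg hM θ _).2 hθ

end LipschitzToHilbert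

/-! ### From a bounded Hilbert transform to a bounded radial derivative. -/

section HilbertToLipschitz

local notation "𝔻" => Metric.ball (0 : ℂ) 1
local notation "𝕋" => Metric.sphere (0 : ℂ) 1
local notation "conj" => starRingEnd _

/-- An everywhere existing, integrable derivative can be integrated back, so `F` is `M`-Lipschitz on
a period and the a.e. bound holds at every point. -/
theorem exists_norm_deriv_le_of_memLinftyCircle {F : ℝ → ℂ} (hF : Differentiable ℝ F)
    (hp : Function.Periodic F (2 * Real.pi)) (hm : MemLinftyCircle (deriv F)) :
    ∃ M, 0 ≤ M ∧ ∀ x, ‖deriv F x‖ ≤ M := by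
  set M := (eLpNorm (deriv F) ⊤ (volume.restrict (Set.Ioc 0 (2 * Real.pi)))).toReal with hMdef
  have hpi := Real.pi_pos
  have hae : ∀ᵐ x : ℝ, x ∈ Set.Ioc 0 (2 * Real.pi) → ‖deriv F x‖ ≤ M := by
    rw [← ae_restrict_iff' measurableSet_Ioc]
    have h := ae_le_eLpNormEssSup (f := deriv F)
      (μ := volume.restrict (Set.Ioc 0 (2 * Real.pi)))
    filter_upwards [h] with x hx
    rw [← eLpNorm_exponent_top] at hx
    have := ENNReal.toReal_mono hm.eLpNorm_lt_top.ne hx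
    rwa [toReal_enorm] at this
  have hint : IntegrableOn (deriv F) (Set.Ioc 0 (2 * Real.pi)) := hm.integrable le_top
  have hlip : ∀ a b, 0 ≤ a → a ≤ b → b ≤ 2 * Real.pi → ‖F b - F a‖ ≤ M * (b - a) := by
    intro a b ha hab hb
    have hsub : Set.Ioc a b ⊆ Set.Ioc 0 (2 * Real.pi) := Set.Ioc_subset_Ioc ha hb
    have hi : IntervalIntegrable (deriv F) volume a b :=
      (intervalIntegrable_iff_integrableOn_Ioc_of_le hab).2 (hint.mono_set hsub)
    rw [← intervalIntegral.integral_eq_sub_of_hasDerivAt (fun x _ => (hF x).hasDerivAt) hi]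
    have := intervalIntegral.norm_integral_le_of_norm_le_const_ae (a := a) (b := b) (C := M)
      (f := deriv F) (by
        filter_upwards [hae] with x hx hxab
        rw [Set.uIoc_of_le hab] at hxab
        exact hx (hsub hxab))
    rwa [abs_of_nonneg (by linarith)] at this
  have hM0 : 0 ≤ M := ENNReal.toReal_nonneg
  refine ⟨M, hM0, ?_⟩
  have key : ∀ x ∈ Set.Ico 0 (2 * Real.pi), ‖deriv F x‖ ≤ M := by
    intro x hx
    have hslope := (hF x).hasDerivAt.tendsto_slope_zero_right
    apply le_of_tendsto hslope.norm
    filter_upwards [Ioo_mem_nhdsGT (show (0 : ℝ) < 2 * Real.pi - x by linarith [hx.2])] with t ht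
    have h1 := hlip x (x + t) hx.1 (by linarith [ht.1]) (by linarith [ht.2])
    rw [norm_smul, norm_inv, Real.norm_of_nonneg ht.1.le, inv_mul_le_iff₀ ht.1]
    linarith
  have hdp : Function.Periodic (deriv F) (2 * Real.pi) := by
    intro x
    rw [← deriv_comp_add_const]
    congr 1
    exact funext hp
  intro x
  obtain ⟨y, hy, hxy⟩ := hdp.exists_mem_Ico₀ (by positivity) x
  rw [hxy]
  exact key y hy

variable {g : ℂ → ℂ}

theorem norm_poissonIntegral_rotate_sub_le (hgc : ContinuousOn g 𝕋)
    (hg : Differentiable ℝ (onCircle g)) {M : ℝ} (hM : ∀ x, ‖deriv (onCircle g) x‖ ≤ M) {z : ℂ}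
    (hz : z ∈ 𝔻) (s : ℝ) :
    ‖poissonIntegral g (Complex.exp (s * Complex.I) * z) - poissonIntegral g z‖ ≤ M * |s| := by
  have hgi := circleIntegrable_of_continuousOn_circle hgc
  have hval : ∀ t : ℝ, g (Complex.exp (s * Complex.I) * circleMap 0 1 t) = onCircle g (s + t) := by
    intro t
    rw [onCircle, circleMap_zero_one, ← Complex.exp_add]
    congr 2; push_cast; ring
  have hint : CircleIntegrable (fun ξ => g (Complex.exp (s * Complex.I) * ξ)) 0 1 := by
    rw [CircleIntegrable]
    simp only [hval]
    exact (hg.continuous.comp (continuous_const.add continuous_id)).intervalIntegrable _ _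
  rw [poissonIntegral_rotate, ← poissonIntegral_sub hint hgi hz]
  apply norm_poissonIntegral_le_of_le _ hz (hint.sub hgi)
  intro ξ hξ
  obtain ⟨t, rfl⟩ : ∃ t, circleMap 0 1 t = ξ := by
    have : ξ ∈ Set.range (circleMap 0 1) := by rw [range_circleMap]; simpa using hξ
    exact this
  rw [Pi.sub_apply, hval, ← onCircle_eq_circleMap g]
  have := convex_univ.norm_image_sub_le_of_norm_deriv_le (f := onCircle g)
    (fun x _ => hg x) (fun x _ => hM x) (Set.mem_univ t) (Set.mem_univ (s + t))
  simpa using this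

theorem hasDerivAt_ofReal_mul_const (z : ℂ) (t : ℝ) :
    HasDerivAt (fun t : ℝ => (t : ℂ) * z) z t := by
  simpa using (Complex.ofRealCLM.hasDerivAt (x := t)).mul_const z

theorem HasDerivAt.add_conj_comp {a b : ℂ → ℂ} {a' b' z c' : ℂ} {c : ℝ → ℂ} {t : ℝ}
    (ha : HasDerivAt a a' z) (hb : HasDerivAt b b' z) (hc : HasDerivAt c c' t) (hz : z = c t) :
    HasDerivAt (fun t => a (c t) + conj (b (c t))) (a' * c' + conj (b' * c')) t := by
  obtain ⟨D, hD, hDv⟩ := hasFDerivAt_add_conj ha hb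
  rw [← hDv]
  exact hD.comp_hasDerivAt_of_eq t hc hz

theorem norm_angular_le {a b : ℂ → ℂ} {a' b' z : ℂ} (ha : HasDerivAt a a' z)
    (hb : HasDerivAt b b' z) {M : ℝ} (hM0 : 0 ≤ M)
    (hM : ∀ s : ℝ, ‖(a (Complex.exp (s * Complex.I) * z) +
      conj (b (Complex.exp (s * Complex.I) * z))) - (a z + conj (b z))‖ ≤ M * |s|) :
    ‖z * a' - conj (z * b')‖ ≤ M := by
  have hc : HasDerivAt (fun s : ℝ => Complex.exp (s * Complex.I) * z) (Complex.I * z) 0 := by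
    have h1 := ((hasDerivAt_ofReal_mul_const Complex.I 0).cexp).mul_const z
    simpa using h1
  have hd := HasDerivAt.add_conj_comp ha hb hc (by simp)
  have := hd.le_of_lip' hM0 (Eventually.of_forall fun s => by simpa using hM s)
  have heq : a' * (Complex.I * z) + conj (b' * (Complex.I * z)) =
      Complex.I * (z * a' - conj (z * b')) := by
    simp only [map_mul, Complex.conj_I]; ring
  rwa [heq, norm_mul, Complex.norm_I, one_mul] at this

theorem norm_add_conj_sq (p q : ℂ) :
    ‖p + conj q‖ ^ 2 = ‖p - conj q‖ ^ 2 + 4 * (p * q).re := by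
  simp only [← Complex.normSq_eq_norm_sq, Complex.normSq_apply, Complex.add_re, Complex.add_im,
    Complex.sub_re, Complex.sub_im, Complex.conj_re, Complex.conj_im, Complex.mul_re]
  ring

/-- The two squared norms differ by `4 Re (p q)`, whose mean is zero because `p 0 = 0`. With `p = z
a'` and `q = z b'` this bounds the radial derivative in `L²` by the angular one. -/
theorem circleAverage_norm_add_conj_sq_le {p q : ℂ → ℂ} (hp : DifferentiableOn ℂ p 𝔻)
    (hq : DifferentiableOn ℂ q 𝔻) (hp0 : p 0 = 0) {M : ℝ}
    (hM : ∀ z ∈ 𝔻, ‖p z - conj (q z)‖ ≤ M) {r : ℝ} (h0 : 0 < r) (h1 : r < 1) :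
    Real.circleAverage (fun z => ‖p z + conj (q z)‖ ^ 2) 0 r ≤ M ^ 2 := by
  have hsub : Metric.closedBall (0 : ℂ) r ⊆ 𝔻 := Metric.closedBall_subset_ball h1
  have hpq : DiffContOnCl ℂ (fun z => p z * q z) (Metric.ball 0 |r|) := by
    apply DifferentiableOn.diffContOnCl
    rw [abs_of_pos h0, closure_ball _ h0.ne']
    exact (hp.mul hq).mono hsub
  have havg := hpq.circleAverage
  simp only [hp0, zero_mul] at havg
  have hsph : Metric.sphere (0 : ℂ) r ⊆ 𝔻 := Metric.sphere_subset_closedBall.trans hsub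
  have hpc := hp.continuousOn.mono hsph
  have hqc := hq.continuousOn.mono hsph
  have hpqi : CircleIntegrable (fun z => p z * q z) 0 r :=
    (hpc.mul hqc).circleIntegrable h0.le
  have hre := Complex.reCLM.circleAverage_comp_comm hpqi
  rw [havg, map_zero] at hre
  have hci : CircleIntegrable (fun z => ‖p z - conj (q z)‖ ^ 2) 0 r := by
    apply ContinuousOn.circleIntegrable h0.le
    exact (hpc.sub (Complex.continuous_conj.comp_continuousOn hqc)).norm.pow 2
  have hci2 : CircleIntegrable (fun z => 4 * (p z * q z).re) 0 r := by
    apply ContinuousOn.circleIntegrable h0.le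
    exact continuousOn_const.mul (Complex.continuous_re.comp_continuousOn (hpc.mul hqc))
  simp only [norm_add_conj_sq]
  rw [Real.circleAverage_fun_add hci hci2]
  have h4 : Real.circleAverage (fun z => 4 * (p z * q z).re) 0 r = 0 := by
    have h5 : Real.circleAverage (fun z => (p z * q z).re) 0 r = 0 := hre
    have := Real.circleAverage_fun_smul (a := (4 : ℝ)) (f := fun z => (p z * q z).re) (c := 0)
      (R := r)
    rw [h5, smul_zero] at this
    exact this
  rw [h4, add_zero]
  apply Real.circleAverage_mono_on_of_le_circle hci
  intro z hz
  rw [abs_of_pos h0] at hz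
  have := hM z (hsph hz)
  gcongr

/-- Cauchy–Schwarz, from the nonnegativity of the variance about the mean `c`. -/
theorem sq_integral_le {k : ℝ → ℝ} {α β : ℝ} (hαβ : α < β) (hk : ContinuousOn k (Set.uIcc α β)) :
    (∫ s in α..β, k s) ^ 2 ≤ (β - α) * ∫ s in α..β, k s ^ 2 := by
  set c := (∫ s in α..β, k s) / (β - α) with hc
  have hl : 0 < β - α := by linarith
  have h0 : 0 ≤ ∫ s in α..β, (k s - c) ^ 2 :=
    intervalIntegral.integral_nonneg hαβ.le fun s _ => sq_nonneg _
  have h1 : (∫ s in α..β, (k s - c) ^ 2) =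
      (∫ s in α..β, k s ^ 2) - 2 * c * (∫ s in α..β, k s) + c ^ 2 * (β - α) := by
    have e : ∀ s, (k s - c) ^ 2 = (k s ^ 2 - 2 * c * k s) + c ^ 2 := fun s => by ring
    simp only [e]
    rw [intervalIntegral.integral_add, intervalIntegral.integral_sub,
      intervalIntegral.integral_const_mul, intervalIntegral.integral_const, smul_eq_mul]
    · ring
    · exact (hk.pow 2).intervalIntegrable
    · exact (continuousOn_const.mul hk).intervalIntegrable
    · exact ((hk.pow 2).sub (continuousOn_const.mul hk)).intervalIntegrable
    · exact intervalIntegrable_const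
  have h2 : (∫ s in α..β, k s) = c * (β - α) := by rw [hc]; field_simp
  rw [h1, h2] at h0
  rw [h2]
  nlinarith

/-- Here `Q` plays the role of `r ∂u/∂r`. The increment is integrated along each radius, estimated
by Cauchy–Schwarz, and averaged by Fubini. -/
theorem circleAverage_norm_sub_sq_le {u Q : ℂ → ℂ} (hu : ContinuousOn u 𝔻)
    (hQ : ContinuousOn Q 𝔻)
    (hd : ∀ ξ ∈ 𝕋, ∀ s ∈ Set.Ioo (0 : ℝ) 1, HasDerivAt (fun s : ℝ => u (s * ξ)) (Q (s * ξ) / s) s)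
    {B : ℝ} (hB : ∀ s ∈ Set.Ioo (0 : ℝ) 1, Real.circleAverage (fun z => ‖Q z‖ ^ 2) 0 s ≤ B)
    {ρ σ : ℝ} (h0 : 0 < ρ) (hρσ : ρ < σ) (hσ : σ < 1) :
    Real.circleAverage (fun ξ => ‖u (σ * ξ) - u (ρ * ξ)‖ ^ 2) 0 1 ≤ (σ - ρ) ^ 2 / ρ ^ 2 * B := by
  have hpi := Real.pi_pos
  have hmem : ∀ s ∈ Set.uIcc ρ σ, s ∈ Set.Ioo (0 : ℝ) 1 := by
    intro s hs
    rw [Set.uIcc_of_le hρσ.le] at hs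
    exact ⟨h0.trans_le hs.1, hs.2.trans_lt hσ⟩
  have hball : ∀ s ∈ Set.Ioo (0 : ℝ) 1, ∀ ξ ∈ 𝕋, (s : ℂ) * ξ ∈ 𝔻 := by
    intro s hs ξ hξ
    rw [mem_sphere_zero_iff_norm] at hξ
    rw [mem_ball_zero_iff, norm_mul, hξ, mul_one, Complex.norm_of_nonneg hs.1.le]
    exact hs.2
  have hQs : ∀ ξ ∈ 𝕋, ContinuousOn (fun s : ℝ => Q (s * ξ)) (Set.uIcc ρ σ) := by
    intro ξ hξ
    exact hQ.comp (by fun_prop) fun s hs => hball s (hmem s hs) ξ hξ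
  have hpt : ∀ ξ ∈ 𝕋, ‖u (σ * ξ) - u (ρ * ξ)‖ ^ 2 ≤
      (σ - ρ) / ρ ^ 2 * ∫ s in ρ..σ, ‖Q (s * ξ)‖ ^ 2 := by
    intro ξ hξ
    have hcont : ContinuousOn (fun s : ℝ => Q (s * ξ) / s) (Set.uIcc ρ σ) :=
      (hQs ξ hξ).div (by fun_prop) fun s hs => by exact_mod_cast (hmem s hs).1.ne'
    have hftc := intervalIntegral.integral_eq_sub_of_hasDerivAt
      (fun s hs => hd ξ hξ s (hmem s hs)) hcont.intervalIntegrable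
    have h1 : ‖u (σ * ξ) - u (ρ * ξ)‖ ≤ ∫ s in ρ..σ, ‖Q (s * ξ)‖ / ρ := by
      rw [← hftc]
      apply intervalIntegral.norm_integral_le_of_norm_le hρσ.le
      · refine Eventually.of_forall fun s hs => ?_
        rw [norm_div, Complex.norm_of_nonneg (h0.trans hs.1).le]
        have := hs.1.le
        gcongr
      · exact ((hQs ξ hξ).norm.div_const ρ).intervalIntegrable
    rw [intervalIntegral.integral_div] at h1
    calc ‖u (σ * ξ) - u (ρ * ξ)‖ ^ 2 ≤ ((∫ s in ρ..σ, ‖Q (s * ξ)‖) / ρ) ^ 2 := by gcongr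
      _ = (∫ s in ρ..σ, ‖Q (s * ξ)‖) ^ 2 / ρ ^ 2 := by rw [div_pow]
      _ ≤ ((σ - ρ) * ∫ s in ρ..σ, ‖Q (s * ξ)‖ ^ 2) / ρ ^ 2 := by
          gcongr
          exact sq_integral_le hρσ (hQs ξ hξ).norm
      _ = _ := by ring
  have hcirc : ∀ θ, circleMap 0 1 θ ∈ 𝕋 := fun θ => circleMap_mem_sphere 0 zero_le_one θ
  have hQ2 : ContinuousOn (fun p : ℝ × ℝ => ‖Q (p.1 * circleMap 0 1 p.2)‖ ^ 2)
      (Set.uIcc ρ σ ×ˢ Set.univ) := by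
    apply ContinuousOn.pow
    apply ContinuousOn.norm
    refine hQ.comp ?_ fun p hp => hball _ (hmem _ hp.1) _ (hcirc _)
    have := continuous_circleMap 0 1
    fun_prop
  have hint : IntegrableOn (Function.uncurry fun s θ : ℝ => ‖Q (s * circleMap 0 1 θ)‖ ^ 2)
      (Set.uIoc ρ σ ×ˢ Set.uIoc 0 (2 * Real.pi)) := by
    have : IntegrableOn (Function.uncurry fun s θ : ℝ => ‖Q (s * circleMap 0 1 θ)‖ ^ 2)
        (Set.uIcc ρ σ ×ˢ Set.uIcc 0 (2 * Real.pi)) :=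
      (hQ2.mono (Set.prod_mono le_rfl (Set.subset_univ _))).integrableOn_compact
        (isCompact_uIcc.prod isCompact_uIcc)
    exact this.mono_set (Set.prod_mono Set.uIoc_subset_uIcc Set.uIoc_subset_uIcc)
  have hswap := intervalIntegral_intervalIntegral_swap
    (F := fun s θ : ℝ => ‖Q (s * circleMap 0 1 θ)‖ ^ 2) (a := ρ) (b := σ) (c := 0)
    (d := 2 * Real.pi) hint
  rw [IntegrableOn, Measure.volume_eq_prod, ← Measure.prod_restrict] at hint
  have hi1 : IntervalIntegrable (fun θ => ∫ s in ρ..σ, ‖Q (s * circleMap 0 1 θ)‖ ^ 2) volume 0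
      (2 * Real.pi) := by
    rw [intervalIntegrable_iff]
    have := hint.integral_prod_right
    simpa only [intervalIntegral.integral_of_le hρσ.le, Set.uIoc_of_le hρσ.le] using! this
  have hi2 : IntervalIntegrable (fun s : ℝ => ∫ θ in 0..2 * Real.pi, ‖Q (s * circleMap 0 1 θ)‖ ^ 2)
      volume ρ σ := by
    rw [intervalIntegrable_iff]
    have := hint.integral_prod_left
    simpa only [intervalIntegral.integral_of_le Real.two_pi_pos.le,
      Set.uIoc_of_le Real.two_pi_pos.le] using! this
  have hcm : ∀ s θ : ℝ, circleMap 0 s θ = s * circleMap 0 1 θ := fun s θ => by simp [circleMap]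
  have hleft : CircleIntegrable (fun ξ => ‖u (σ * ξ) - u (ρ * ξ)‖ ^ 2) 0 1 := by
    apply ContinuousOn.circleIntegrable zero_le_one
    apply ContinuousOn.pow
    apply ContinuousOn.norm
    apply ContinuousOn.sub
    · exact hu.comp (by fun_prop) fun ξ hξ => hball σ (hmem σ Set.right_mem_uIcc) ξ hξ
    · exact hu.comp (by fun_prop) fun ξ hξ => hball ρ (hmem ρ Set.left_mem_uIcc) ξ hξ
  have hright : CircleIntegrable
      (fun ξ => (σ - ρ) / ρ ^ 2 * ∫ s in ρ..σ, ‖Q (s * ξ)‖ ^ 2) 0 1 :=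
    IntervalIntegrable.const_mul hi1 _
  refine (Real.circleAverage_mono hleft hright fun ξ hξ => hpt ξ (by rwa [abs_one] at hξ)).trans ?_
  rw [Real.circleAverage, intervalIntegral.integral_const_mul, ← hswap, smul_eq_mul]
  have hle : ∫ s in ρ..σ, ∫ θ in 0..2 * Real.pi, ‖Q (s * circleMap 0 1 θ)‖ ^ 2 ≤
      ∫ _ in ρ..σ, 2 * Real.pi * B := by
    apply intervalIntegral.integral_mono_on hρσ.le hi2 intervalIntegrable_const
    intro s hs
    rw [← Set.uIcc_of_le hρσ.le] at hs
    have := hB s (hmem s hs)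
    rw [Real.circleAverage, smul_eq_mul, inv_mul_le_iff₀ (by positivity)] at this
    simpa only [hcm s] using this
  rw [intervalIntegral.integral_const, smul_eq_mul] at hle
  have hk : 0 ≤ (σ - ρ) / ρ ^ 2 := div_nonneg (by linarith) (by positivity)
  calc _ ≤ (2 * Real.pi)⁻¹ * ((σ - ρ) / ρ ^ 2 * ((σ - ρ) * (2 * Real.pi * B))) := by gcongr
    _ = _ := by field_simp

theorem circleAverage_norm_sub_poissonIntegral_sq_le (hgc : ContinuousOn g 𝕋)
    (hg : Differentiable ℝ (onCircle g)) {M : ℝ} (hM0 : 0 ≤ M)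
    (hM : ∀ x, ‖deriv (onCircle g) x‖ ≤ M) {ρ : ℝ} (h0 : 0 < ρ) (h1 : ρ < 1) :
    Real.circleAverage (fun ξ => ‖g ξ - poissonIntegral g (ρ * ξ)‖ ^ 2) 0 1 ≤
      (1 - ρ) ^ 2 / ρ ^ 2 * M ^ 2 := by
  have hgi := circleIntegrable_of_continuousOn_circle hgc
  set a := herglotzPart g with ha
  set b := herglotzPart (fun ξ => conj (g ξ)) with hb
  have haA := analyticOnNhd_herglotzPart hgi
  have hbA := analyticOnNhd_herglotzPart hgi.conj_comp
  have hu : ∀ z ∈ 𝔻, poissonIntegral g z = a z + conj (b z) := fun z hz =>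
    poissonIntegral_eq_add_conj hgi hz
  have hda : ∀ z ∈ 𝔻, HasDerivAt a (deriv a z) z := fun z hz =>
    (haA z hz).differentiableAt.hasDerivAt
  have hdb : ∀ z ∈ 𝔻, HasDerivAt b (deriv b z) z := fun z hz =>
    (hbA z hz).differentiableAt.hasDerivAt
  have hda' : DifferentiableOn ℂ (fun z => z * deriv a z) 𝔻 :=
    differentiableOn_id.mul haA.deriv.differentiableOn
  have hdb' : DifferentiableOn ℂ (fun z => z * deriv b z) 𝔻 :=
    differentiableOn_id.mul hbA.deriv.differentiableOn
  have hrot : ∀ z ∈ 𝔻, ‖z * deriv a z - conj (z * deriv b z)‖ ≤ M := by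
    intro z hz
    apply norm_angular_le (hda z hz) (hdb z hz) hM0
    intro s
    have hsz : Complex.exp (s * Complex.I) * z ∈ 𝔻 := by
      rw [mem_ball_zero_iff] at hz ⊢
      rwa [norm_mul, Complex.norm_exp_ofReal_mul_I, one_mul]
    rw [← hu z hz, ← hu _ hsz]
    exact norm_poissonIntegral_rotate_sub_le hgc hg hM hz s
  have huc : ContinuousOn (poissonIntegral g) 𝔻 := (harmonicOnNhd_poissonIntegral hgi).continuousOn
  have hQc : ContinuousOn (fun z => z * deriv a z + conj (z * deriv b z)) 𝔻 :=
    hda'.continuousOn.add (Complex.continuous_conj.comp_continuousOn hdb'.continuousOn)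
  have hball : ∀ s ∈ Set.Ioo (0 : ℝ) 1, ∀ ξ ∈ 𝕋, (s : ℂ) * ξ ∈ 𝔻 := by
    intro s hs ξ hξ
    rw [mem_sphere_zero_iff_norm] at hξ
    rw [mem_ball_zero_iff, norm_mul, hξ, mul_one, Complex.norm_of_nonneg hs.1.le]
    exact hs.2
  have hder : ∀ ξ ∈ 𝕋, ∀ s ∈ Set.Ioo (0 : ℝ) 1,
      HasDerivAt (fun s : ℝ => poissonIntegral g (s * ξ))
        ((s * ξ * deriv a (s * ξ) + conj (s * ξ * deriv b (s * ξ))) / s) s := by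
    intro ξ hξ s hs
    have hm := hball s hs ξ hξ
    have h := HasDerivAt.add_conj_comp (hda _ hm) (hdb _ hm) (hasDerivAt_ofReal_mul_const ξ s) rfl
    have hs0 : (s : ℂ) ≠ 0 := by exact_mod_cast hs.1.ne'
    refine (h.congr_of_eventuallyEq ?_).congr_deriv ?_
    · filter_upwards [Ioo_mem_nhds hs.1 hs.2] with t ht
      exact hu _ (hball t ht ξ hξ)
    · simp only [map_mul, Complex.conj_ofReal]
      field_simp
  have hσ : ∀ σ, ρ < σ → σ < 1 → Real.circleAverage
      (fun ξ => ‖poissonIntegral g (σ * ξ) - poissonIntegral g (ρ * ξ)‖ ^ 2) 0 1 ≤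
        (σ - ρ) ^ 2 / ρ ^ 2 * M ^ 2 := fun σ hρσ hσ1 =>
    circleAverage_norm_sub_sq_le huc hQc hder (fun s hs =>
      circleAverage_norm_add_conj_sq_le hda' hdb' (by simp) hrot hs.1 hs.2) h0 hρσ hσ1
  obtain ⟨C, hC⟩ := (isCompact_sphere (0 : ℂ) 1).exists_bound_of_continuousOn hgc
  have huC : ∀ z ∈ 𝔻, ‖poissonIntegral g z‖ ≤ C := fun z hz =>
    norm_poissonIntegral_le_of_le hC hz hgi
  have hlim : Tendsto (fun ε : ℝ => Real.circleAverage
      (fun ξ => ‖poissonIntegral g (((1 - ε : ℝ) : ℂ) * ξ) - poissonIntegral g (ρ * ξ)‖ ^ 2) 0 1)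
      (𝓝[>] 0) (𝓝 (Real.circleAverage
        (fun ξ => ‖g ξ - poissonIntegral g (ρ * ξ)‖ ^ 2) 0 1)) := by
    apply tendsto_circleAverage_of_dominated (C := (C + C) ^ 2)
    · filter_upwards [Ioo_mem_nhdsGT (zero_lt_one (α := ℝ))] with ε hε
      apply ContinuousOn.circleIntegrable zero_le_one
      apply ContinuousOn.pow
      apply ContinuousOn.norm
      apply ContinuousOn.sub
      · exact huc.comp (by fun_prop) fun ξ hξ =>
          hball _ ⟨by linarith [hε.2], by linarith [hε.1]⟩ ξ hξ
      · exact huc.comp (by fun_prop) fun ξ hξ => hball ρ ⟨h0, h1⟩ ξ hξ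
    · filter_upwards [Ioo_mem_nhdsGT (zero_lt_one (α := ℝ))] with ε hε ξ hξ
      rw [Real.norm_of_nonneg (by positivity)]
      gcongr
      exact norm_sub_le_of_le (huC _ (hball _ ⟨by linarith [hε.2], by linarith [hε.1]⟩ ξ hξ))
        (huC _ (hball ρ ⟨h0, h1⟩ ξ hξ))
    · refine Eventually.of_forall fun θ => ?_
      have hθ := circleMap_mem_sphere 0 zero_le_one θ
      have := (tendsto_poissonIntegral_of_continuousOn hgc hθ).comp (tendsto_radial hθ)
      exact ((this.sub_const _).norm).pow 2
  apply le_of_tendsto_of_tendsto hlim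
    (g := fun ε : ℝ => (1 - ε - ρ) ^ 2 / ρ ^ 2 * M ^ 2)
  · have : Continuous (fun ε : ℝ => (1 - ε - ρ) ^ 2 / ρ ^ 2 * M ^ 2) := by fun_prop
    have h := (this.tendsto 0).mono_left (nhdsWithin_le_nhds (s := Set.Ioi 0))
    simpa using h
  · filter_upwards [Ioo_mem_nhdsGT (show (0 : ℝ) < 1 - ρ by linarith)] with ε hε
    exact hσ (1 - ε) (by linarith [hε.2]) (by linarith [hε.1])

/-- Pointwise `x ≤ m + (min x k - m)⁺ + x² / k`. The middle term is bounded, hence open to dominated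
convergence; the last is controlled in `L²` and small for large `k`. -/
theorem norm_poissonIntegral_le_add {D : ℂ → ℂ} (hDc : ContinuousOn D 𝕋) {z : ℂ} (hz : z ∈ 𝔻) {C k m B : ℝ} (hk : 0 < k)
    (hC : ∀ ξ ∈ 𝕋, poissonKernel 0 z ξ ≤ C)
    (hB : Real.circleAverage (fun ξ => ‖D ξ‖ ^ 2) 0 1 ≤ B) (hC0 : 0 ≤ C) :
    ‖poissonIntegral D z‖ ≤ m + Real.circleAverage
      (fun ξ => poissonKernel 0 z ξ * max (min ‖D ξ‖ k - m) 0) 0 1 + C * B / k := by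
  refine (norm_poissonIntegral_le hz).trans ?_
  have hkc := continuousOn_poissonKernel hz
  have hmc : ContinuousOn (fun ξ => max (min ‖D ξ‖ k - m) 0) 𝕋 :=
    (show Continuous fun x : ℝ => max (min x k - m) 0 by fun_prop).comp_continuousOn hDc.norm
  have i0 : CircleIntegrable (fun ξ => poissonKernel 0 z ξ * ‖D ξ‖) 0 1 :=
    (hkc.mul hDc.norm).circleIntegrable zero_le_one
  have i1 : CircleIntegrable (fun ξ => m • poissonKernel 0 z ξ) 0 1 :=
    (hkc.const_smul m).circleIntegrable zero_le_one
  have i2 : CircleIntegrable (fun ξ => poissonKernel 0 z ξ * max (min ‖D ξ‖ k - m) 0) 0 1 :=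
    (hkc.mul hmc).circleIntegrable zero_le_one
  have i3 : CircleIntegrable (fun ξ => (C / k) • ‖D ξ‖ ^ 2) 0 1 :=
    ((hDc.norm.pow 2).const_smul (C / k)).circleIntegrable zero_le_one
  have i12 : CircleIntegrable (fun ξ => m • poissonKernel 0 z ξ +
      poissonKernel 0 z ξ * max (min ‖D ξ‖ k - m) 0) 0 1 := i1.add i2
  have hle : Real.circleAverage (fun ξ => poissonKernel 0 z ξ * ‖D ξ‖) 0 1 ≤
      Real.circleAverage (fun ξ => (m • poissonKernel 0 z ξ +
        poissonKernel 0 z ξ * max (min ‖D ξ‖ k - m) 0) + (C / k) • ‖D ξ‖ ^ 2) 0 1 := by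
    refine Real.circleAverage_mono i0 (i12.add i3) fun ξ hξ => ?_
    rw [abs_one] at hξ
    have hp := poissonKernel_nonneg hz hξ
    have hpC := hC ξ hξ
    set x := ‖D ξ‖ with hx
    have hx0 : 0 ≤ x := norm_nonneg _
    have h1 : x ≤ m + max (min x k - m) 0 + x ^ 2 / k := by
      have h2 := le_max_left (min x k - m) 0
      have h3 : 0 ≤ x ^ 2 / k := by positivity
      rcases le_total x k with h | h
      · rw [min_eq_left h] at h2 ⊢; linarith
      · have h4 : x ≤ x ^ 2 / k := by rw [le_div_iff₀ hk]; nlinarith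
        rw [min_eq_right h] at h2 ⊢; linarith
    have h5 : poissonKernel 0 z ξ * (x ^ 2 / k) ≤ C * (x ^ 2 / k) := by gcongr
    calc poissonKernel 0 z ξ * x ≤ poissonKernel 0 z ξ * (m + max (min x k - m) 0 + x ^ 2 / k) := by
          gcongr
      _ ≤ _ := by
          simp only [smul_eq_mul]
          have : C / k * x ^ 2 = C * (x ^ 2 / k) := by ring
          rw [this]; linarith
  refine hle.trans ?_
  rw [Real.circleAverage_fun_add i12 i3, Real.circleAverage_fun_add i1 i2,
    Real.circleAverage_fun_smul, Real.circleAverage_fun_smul, circleAverage_poissonKernel hz,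
    smul_eq_mul, mul_one, smul_eq_mul]
  have : C / k * Real.circleAverage (fun ξ => ‖D ξ‖ ^ 2) 0 1 ≤ C * B / k := by
    calc _ ≤ C / k * B := by gcongr
      _ = _ := by ring
  linarith

/-- The Poisson integral at `z` of the boundary quotient `D ε` is the quotient `(u(z) - u((1-ε)z)) /
ε`, which tends to the radial derivative at `z`. On the circle `D ε` tends a.e. to `h`, and its `L²`
bound prevents mass from escaping in the limit. -/
theorem norm_radial_le (hgc : ContinuousOn g 𝕋) (hg : Differentiable ℝ (onCircle g)) {M : ℝ}
    (hM0 : 0 ≤ M) (hM : ∀ x, ‖deriv (onCircle g) x‖ ≤ M) {h : ℝ → ℂ} {m : ℝ}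
    (hm : ∀ᵐ θ ∂(volume.restrict (Set.Ioc 0 (2 * Real.pi))), ‖h θ‖ ≤ m)
    (hh : ∀ᵐ θ ∂(volume.restrict (Set.Ioc 0 (2 * Real.pi))),
      Tendsto (radialQuotient g θ) (𝓝[>] 0) (𝓝 (h θ)))
    {z : ℂ} (hz : z ∈ 𝔻) :
    ‖z * deriv (herglotzPart g) z +
      conj (z * deriv (herglotzPart (fun ξ => conj (g ξ))) z)‖ ≤ m := by
  have hgi := circleIntegrable_of_continuousOn_circle hgc
  set a := herglotzPart g with ha
  set b := herglotzPart (fun ξ => conj (g ξ)) with hb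
  have haA := analyticOnNhd_herglotzPart hgi
  have hbA := analyticOnNhd_herglotzPart hgi.conj_comp
  have hu : ∀ z ∈ 𝔻, poissonIntegral g z = a z + conj (b z) := fun z hz =>
    poissonIntegral_eq_add_conj hgi hz
  have huc : ContinuousOn (poissonIntegral g) 𝔻 := (harmonicOnNhd_poissonIntegral hgi).continuousOn
  have hball : ∀ ε ∈ Set.Ioo (0 : ℝ) 1, ∀ ξ ∈ Metric.closedBall (0 : ℂ) 1,
      ((1 - ε : ℝ) : ℂ) * ξ ∈ 𝔻 := by
    intro ε hε ξ hξ
    rw [mem_closedBall_zero_iff] at hξ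
    rw [mem_ball_zero_iff, norm_mul, Complex.norm_of_nonneg (by linarith [hε.2])]
    nlinarith [hε.1, hε.2, norm_nonneg ξ]
  set D : ℝ → ℂ → ℂ := fun ε ξ => (g ξ - poissonIntegral g (((1 - ε : ℝ) : ℂ) * ξ)) / ε with hD
  have hDc : ∀ ε ∈ Set.Ioo (0 : ℝ) 1, ContinuousOn (D ε) 𝕋 := by
    intro ε hε
    apply ContinuousOn.div_const
    apply hgc.sub
    exact huc.comp (by fun_prop) fun ξ hξ => hball ε hε ξ (Metric.sphere_subset_closedBall hξ)
  have hDB : ∀ ε ∈ Set.Ioo (0 : ℝ) (1 / 2),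
      Real.circleAverage (fun ξ => ‖D ε ξ‖ ^ 2) 0 1 ≤ 4 * M ^ 2 := by
    intro ε hε
    have h1 := circleAverage_norm_sub_poissonIntegral_sq_le hgc hg hM0 hM (ρ := 1 - ε)
      (by linarith [hε.2]) (by linarith [hε.1])
    have h2 : ∀ ξ, ‖D ε ξ‖ ^ 2 =
        (ε ^ 2)⁻¹ • ‖g ξ - poissonIntegral g (((1 - ε : ℝ) : ℂ) * ξ)‖ ^ 2 := by
      intro ξ
      simp only [hD, norm_div, Complex.norm_of_nonneg hε.1.le, div_pow, smul_eq_mul]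
      ring
    simp only [h2]
    rw [Real.circleAverage_fun_smul, smul_eq_mul, inv_mul_le_iff₀ (by have := hε.1; positivity)]
    refine h1.trans ?_
    have h3 : (1 / 2 : ℝ) ^ 2 ≤ (1 - ε) ^ 2 := by
      have := hε.2
      gcongr; linarith
    have h4 : 0 ≤ ε ^ 2 * M ^ 2 := by positivity
    rw [show 1 - (1 - ε) = ε by ring, div_mul_eq_mul_div, div_le_iff₀ (by nlinarith)]
    nlinarith
  have hDP : ∀ ε ∈ Set.Ioo (0 : ℝ) 1, poissonIntegral (D ε) z =
      (poissonIntegral g z - poissonIntegral g (((1 - ε : ℝ) : ℂ) * z)) / ε := by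
    intro ε hε
    have hdc : ∀ c : ℂ → ℂ, AnalyticOnNhd ℂ c 𝔻 →
        DiffContOnCl ℂ (fun ξ => c (((1 - ε : ℝ) : ℂ) * ξ)) 𝔻 := by
      intro c hc
      apply DifferentiableOn.diffContOnCl
      rw [closure_ball _ one_ne_zero]
      exact hc.differentiableOn.comp (by fun_prop) fun ξ hξ => hball ε hε ξ hξ
    have h1 := poissonIntegral_of_diffContOnCl (hdc a haA) (hdc b hbA) hz
    rw [← hu _ (hball ε hε z (Metric.ball_subset_closedBall hz))] at h1
    have h2 : poissonIntegral (fun ξ => poissonIntegral g (((1 - ε : ℝ) : ℂ) * ξ)) z =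
        poissonIntegral g (((1 - ε : ℝ) : ℂ) * z) := by
      rw [← h1]
      apply Real.circleAverage_congr_sphere
      intro ξ hξ
      rw [abs_one] at hξ
      simp only [hu _ (hball ε hε ξ (Metric.sphere_subset_closedBall hξ))]
    have h3 : CircleIntegrable (fun ξ => poissonIntegral g (((1 - ε : ℝ) : ℂ) * ξ)) 0 1 := by
      apply ContinuousOn.circleIntegrable zero_le_one
      exact huc.comp (by fun_prop) fun ξ hξ => hball ε hε ξ (Metric.sphere_subset_closedBall hξ)
    simp only [hD, div_eq_inv_mul]
    rw [poissonIntegral_const_mul, poissonIntegral_sub hgi h3 hz, h2]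
  have hlimit : Tendsto (fun ε : ℝ => poissonIntegral (D ε) z) (𝓝[>] 0)
      (𝓝 (z * deriv a z + conj (z * deriv b z))) := by
    have hd := HasDerivAt.add_conj_comp (haA z hz).differentiableAt.hasDerivAt
      (hbA z hz).differentiableAt.hasDerivAt
      (c := fun ε : ℝ => ((1 - ε : ℝ) : ℂ) * z) (c' := -z) (t := 0) (by
        have e : (fun ε : ℝ => ((1 - ε : ℝ) : ℂ) * z) = fun ε : ℝ => z - ε * z := by
          ext ε; push_cast; ring
        rw [e]
        exact (hasDerivAt_ofReal_mul_const z 0).const_sub z) (by simp)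
    have hs := hd.tendsto_slope_zero_right.neg
    refine (hs.congr' ?_).trans_eq ?_
    · filter_upwards [Ioo_mem_nhdsGT (zero_lt_one (α := ℝ))] with ε hε
      rw [hDP ε hε, hu z hz, hu _ (hball ε hε z (Metric.ball_subset_closedBall hz))]
      simp [div_eq_inv_mul]
      ring
    · congr 1
      simp only [map_mul, map_neg]; ring
  obtain ⟨C, hC0, hC⟩ := exists_poissonKernel_le hz
  refine le_of_forall_pos_le_add fun δ hδ => ?_
  -- This level makes the `L²` tail at most `δ`; the `+ 1` keeps `k` positive when `M = 0`.
  set k := (C * (4 * M ^ 2) + 1) / δ with hk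
  have hk0 : 0 < k := by positivity
  have hkδ : C * (4 * M ^ 2) / k ≤ δ := by
    rw [div_le_iff₀ hk0, hk, mul_div_cancel₀ _ hδ.ne']; linarith
  have htrunc : Tendsto (fun ε : ℝ => Real.circleAverage
      (fun ξ => poissonKernel 0 z ξ * max (min ‖D ε ξ‖ k - m) 0) 0 1) (𝓝[>] 0)
      (𝓝 (Real.circleAverage (fun _ => (0 : ℝ)) 0 1)) := by
    apply tendsto_circleAverage_of_dominated (C := C * (k + |m|))
    · filter_upwards [Ioo_mem_nhdsGT (zero_lt_one (α := ℝ))] with ε hε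
      apply ContinuousOn.circleIntegrable zero_le_one
      apply (continuousOn_poissonKernel hz).mul
      exact (show Continuous fun x : ℝ => max (min x k - m) 0 by fun_prop).comp_continuousOn
        (hDc ε hε).norm
    · refine Eventually.of_forall fun ε ξ hξ => ?_
      rw [norm_mul, Real.norm_of_nonneg (poissonKernel_nonneg hz hξ),
        Real.norm_of_nonneg (le_max_right _ _)]
      apply mul_le_mul (hC ξ hξ) _ (le_max_right _ _) hC0.le
      apply max_le _ (by positivity)
      linarith [min_le_right ‖D ε ξ‖ k, neg_abs_le m]
    · filter_upwards [hm, hh] with θ hmθ hhθ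
      have h1 : Tendsto (fun ε => D ε (circleMap 0 1 θ)) (𝓝[>] 0) (𝓝 (h θ)) := by
        refine hhθ.congr fun ε => ?_
        simp only [radialQuotient, hD, onCircle_eq_circleMap, circleMap_zero_one]
      have h2 := ((((h1.norm.min (tendsto_const_nhds (x := k))).sub_const m).max
        (tendsto_const_nhds (x := (0 : ℝ)))).const_mul (poissonKernel 0 z (circleMap 0 1 θ)) :)
      have h3 : max (min ‖h θ‖ k - m) 0 = 0 :=
        max_eq_right (by linarith [min_le_left ‖h θ‖ k])
      rw [h3, mul_zero] at h2
      exact h2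
  rw [Real.circleAverage_const] at htrunc
  have hup : Tendsto (fun ε : ℝ => m + Real.circleAverage
      (fun ξ => poissonKernel 0 z ξ * max (min ‖D ε ξ‖ k - m) 0) 0 1 + C * (4 * M ^ 2) / k)
      (𝓝[>] 0) (𝓝 (m + 0 + C * (4 * M ^ 2) / k)) := (htrunc.const_add m).add_const _
  have hfin := le_of_tendsto_of_tendsto hlimit.norm hup (by
    filter_upwards [Ioo_mem_nhdsGT (show (0 : ℝ) < 1 / 2 by norm_num)] with ε hε
    have hε' : ε ∈ Set.Ioo (0 : ℝ) 1 := ⟨hε.1, by linarith [hε.2]⟩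
    exact norm_poissonIntegral_le_add (hDc ε hε') hz hk0
      hC (hDB ε hε) hC0.le)
  linarith

end HilbertToLipschitz

/-! ### Assembly: Lipschitz bounds for the Poisson integral and for `f - u`. -/

section Equivalence

local notation "𝔻" => Metric.ball (0 : ℂ) 1
local notation "𝕋" => Metric.sphere (0 : ℂ) 1
local notation "conj" => starRingEnd _

/-- The factor `z` is harmless for `|z| ≥ 1/2`; near the origin `a'` is bounded by compactness. -/
theorem exists_lipschitzOnWith_of_norm_mul_deriv_le {a : ℂ → ℂ} (ha : AnalyticOnNhd ℂ a 𝔻) {R : ℝ}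
    (hR : ∀ z ∈ 𝔻, ‖z * deriv a z‖ ≤ R) : ∃ K : NNReal, LipschitzOnWith K a 𝔻 := by
  have hsub : Metric.closedBall (0 : ℂ) (1 / 2) ⊆ 𝔻 := Metric.closedBall_subset_ball (by norm_num)
  obtain ⟨C, hC⟩ := (isCompact_closedBall (0 : ℂ) (1 / 2)).exists_bound_of_continuousOn
    (ha.deriv.continuousOn.mono hsub)
  refine ⟨(max C (2 * R)).toNNReal, (convex_ball 0 1).lipschitzOnWith_of_nnnorm_deriv_le
    (fun z hz => (ha z hz).differentiableAt) fun z hz => ?_⟩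
  rw [← NNReal.coe_le_coe, coe_nnnorm]
  refine le_trans ?_ (Real.le_coe_toNNReal _)
  rcases le_total ‖z‖ (1 / 2) with h | h
  · exact (hC z (mem_closedBall_zero_iff.2 h)).trans (le_max_left _ _)
  · refine le_trans ?_ (le_max_right _ _)
    have := hR z hz
    rw [norm_mul] at this
    nlinarith [norm_nonneg (deriv a z)]

/-- The sum and the difference of the radial and angular bounds control `z a'` and `z b'`
separately. -/
theorem exists_lipschitzOnWith_poissonIntegral {g : ℂ → ℂ} (hgc : ContinuousOn g 𝕋)
    (hg : Differentiable ℝ (onCircle g)) (hm : MemLinftyCircle (deriv (onCircle g)))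
    (hH : HilbertTransformMemLinfty (deriv (onCircle g))) :
    ∃ L : NNReal, LipschitzOnWith L (poissonIntegral g) 𝔻 := by
  obtain ⟨M, hM0, hM⟩ := exists_norm_deriv_le_of_memLinftyCircle hg (onCircle_periodic g) hm
  obtain ⟨h, hh, hlim⟩ := hH
  obtain ⟨m, hm'⟩ : ∃ m : ℝ, ∀ᵐ θ ∂(volume.restrict (Set.Ioc 0 (2 * Real.pi))), ‖h θ‖ ≤ m := by
    refine ⟨(eLpNormEssSup h (volume.restrict (Set.Ioc 0 (2 * Real.pi)))).toReal, ?_⟩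
    filter_upwards [ae_le_eLpNormEssSup (f := h)
      (μ := volume.restrict (Set.Ioc 0 (2 * Real.pi)))] with x hx
    have htop := hh.eLpNorm_lt_top.ne
    rw [eLpNorm_exponent_top] at htop
    have := ENNReal.toReal_mono htop hx
    rwa [toReal_enorm] at this
  have hlim' : ∀ᵐ θ ∂(volume.restrict (Set.Ioc 0 (2 * Real.pi))),
      Tendsto (radialQuotient g θ) (𝓝[>] 0) (𝓝 (h θ)) :=
    hlim.mono fun θ hθ => (hasHilbertTransformAt_deriv_iff hg hM θ _).1 hθ
  have hgi := circleIntegrable_of_continuousOn_circle hgc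
  set a := herglotzPart g with ha
  set b := herglotzPart (fun ξ => conj (g ξ)) with hb
  have haA := analyticOnNhd_herglotzPart hgi
  have hbA := analyticOnNhd_herglotzPart hgi.conj_comp
  have hu : ∀ z ∈ 𝔻, poissonIntegral g z = a z + conj (b z) := fun z hz =>
    poissonIntegral_eq_add_conj hgi hz
  have hrad : ∀ z ∈ 𝔻, ‖z * deriv a z + conj (z * deriv b z)‖ ≤ m := fun z hz =>
    norm_radial_le hgc hg hM0 hM hm' hlim' hz
  have hang : ∀ z ∈ 𝔻, ‖z * deriv a z - conj (z * deriv b z)‖ ≤ M := by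
    intro z hz
    apply norm_angular_le (haA z hz).differentiableAt.hasDerivAt
      (hbA z hz).differentiableAt.hasDerivAt hM0
    intro s
    have hsz : Complex.exp (s * Complex.I) * z ∈ 𝔻 := by
      rw [mem_ball_zero_iff] at hz ⊢
      rwa [norm_mul, Complex.norm_exp_ofReal_mul_I, one_mul]
    rw [← hu z hz, ← hu _ hsz]
    exact norm_poissonIntegral_rotate_sub_le hgc hg hM hz s
  obtain ⟨Ka, hKa⟩ := exists_lipschitzOnWith_of_norm_mul_deriv_le haA (R := m + M) fun z hz => by
    have h3 : 2 * (z * deriv a z) = (z * deriv a z + conj (z * deriv b z)) +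
        (z * deriv a z - conj (z * deriv b z)) := by ring
    have h4 : ‖2 * (z * deriv a z)‖ ≤ m + M := by
      rw [h3]; exact norm_add_le_of_le (hrad z hz) (hang z hz)
    rw [norm_mul, Complex.norm_ofNat] at h4
    linarith [norm_nonneg (z * deriv a z)]
  obtain ⟨Kb, hKb⟩ := exists_lipschitzOnWith_of_norm_mul_deriv_le hbA (R := m + M) fun z hz => by
    have h3 : 2 * conj (z * deriv b z) = (z * deriv a z + conj (z * deriv b z)) -
        (z * deriv a z - conj (z * deriv b z)) := by ring
    have h4 : ‖2 * conj (z * deriv b z)‖ ≤ m + M := by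
      rw [h3]; exact norm_sub_le_of_le (hrad z hz) (hang z hz)
    rw [norm_mul, Complex.norm_ofNat, RCLike.norm_conj] at h4
    linarith [norm_nonneg (z * deriv b z)]
  refine ⟨Ka + Kb, LipschitzOnWith.of_dist_le_mul fun z hz w hw => ?_⟩
  rw [hu z hz, hu w hw]
  have h1 := hKa.dist_le_mul z hz w hw
  have h2 := hKb.dist_le_mul z hz w hw
  have h3 : dist (conj (b z)) (conj (b w)) = dist (b z) (b w) := Complex.dist_conj_conj _ _
  have h4 := dist_add_add_le (a z) (conj (b z)) (a w) (conj (b w))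
  push_cast
  linarith

theorem continuousOn_laplacian {f : ℂ → ℂ} {s : Set ℂ} (hs : IsOpen s)
    (hf : ContDiffOn ℝ 2 f s) : ContinuousOn (Laplacian.laplacian f : ℂ → ℂ) s := by
  have h := hf.continuousOn_iteratedFDerivWithin (m := 2) le_rfl hs.uniqueDiffOn
  have h2 : ContinuousOn (iteratedFDeriv ℝ 2 f) s :=
    h.congr fun x hx => (iteratedFDerivWithin_of_isOpen 2 hs hx).symm
  rw [InnerProductSpace.laplacian_eq_iteratedFDeriv_complexPlane]
  have hev : ∀ v : Fin 2 → ℂ, Continuous fun m : ContinuousMultilinearMap ℝ (fun _ : Fin 2 => ℂ) ℂ =>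
      m v := fun v => continuous_eval_const v
  exact ((hev _).comp_continuousOn h2).add ((hev _).comp_continuousOn h2)

theorem exists_lipschitzOnWith_sub_poissonIntegral {f b g : ℂ → ℂ} (hgc : ContinuousOn g 𝕋)
    (hf : ContDiffOn ℝ 2 f 𝔻)
    (hf0 : ∀ ζ ∈ 𝕋, Tendsto f (𝓝[𝔻] ζ) (𝓝 (g ζ)))
    (hf1 : ∀ ζ ∈ 𝕋, Tendsto (Laplacian.laplacian f : ℂ → ℂ) (𝓝[𝔻] ζ) (𝓝 (b ζ))) :
    ∃ L : NNReal, LipschitzOnWith L (fun z => f z - poissonIntegral g z) 𝔻 := by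
  have hgi := circleIntegrable_of_continuousOn_circle hgc
  obtain ⟨N, hN⟩ := exists_norm_le_of_tendsto_boundary
    (continuousOn_laplacian Metric.isOpen_ball hf) hf1
  have hfc : ∀ z ∈ 𝔻, ContDiffAt ℝ 2 f z := fun z hz =>
    hf.contDiffAt (Metric.isOpen_ball.mem_nhds hz)
  have hharm := harmonicOnNhd_poissonIntegral hgi
  apply exists_lipschitzOnWith_of_laplacian_le (N := N)
  · exact fun z hz => (hfc z hz).sub (hharm z hz).1
  · intro z hz
    have h1 := (hfc z hz).laplacian_sub (hharm z hz).1
    have h2 := (hharm z hz).2.eq_of_nhds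
    rw [h2, Pi.zero_apply, sub_zero] at h1
    exact (congrArg norm h1).trans_le (hN z hz)
  · intro ζ hζ
    have := (hf0 ζ hζ).sub (tendsto_poissonIntegral_of_continuousOn hgc hζ)
    rwa [sub_self] at this

end Equivalence

theorem theorem1p10 (n : ℕ) (hn : 2 ≤ n) (φ : ℕ → ℂ → ℂ)
    (hφn : ContinuousOn (φ n) (Metric.closedBall 0 1))
    (hφk : ∀ k < n, ContinuousOn (φ k) (Metric.sphere 0 1))
    (hφ0 : Differentiable ℝ (onCircle (φ 0)))
    (f : ℂ → ℂ) (hf : IsPolyharmonicSolution n φ f) :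
    (∃ L : NNReal, LipschitzOnWith L f (Metric.ball 0 1)) ↔
      (MemLinftyCircle (deriv (onCircle (φ 0))) ∧
        HilbertTransformMemLinfty (deriv (onCircle (φ 0)))) := by
  have hgc := hφk 0 (by omega)
  have hC2 : ContDiffOn ℝ 2 f (Metric.ball 0 1) :=
    hf.contDiffOn.of_le (by exact_mod_cast (by omega : 2 ≤ 2 * n))
  -- Here `n ≥ 2` is essential: the boundary condition for `k = 1` is what bounds `Δf`.
  obtain ⟨K, hK⟩ := exists_lipschitzOnWith_sub_poissonIntegral hgc hC2
    (hf.boundary 0 (by omega)) (hf.boundary 1 (by omega))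
  constructor
  · rintro ⟨L, hL⟩
    have hu : LipschitzOnWith (L + K) (poissonIntegral (φ 0)) (Metric.ball 0 1) := by
      have := hL.sub hK
      simpa using this
    exact memLinfty_of_lipschitzOnWith_poissonIntegral hgc hφ0 hu
  · rintro ⟨hm, hH⟩
    obtain ⟨L, hL⟩ := exists_lipschitzOnWith_poissonIntegral hgc hφ0 hm hH
    refine ⟨L + K, ?_⟩
    have := hL.add hK
    simpa using this
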